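/- Let $d\ge 1$ and let $P(X)=X^d+a_{d-1}X^{d-1}+\cdots+a_0\in\mathbb Z[X]$ be a monic polynomial without multiple roots (for instance an irreducible one), with complex roots $\alpha_1,\dots,\alpha_d$. For $x\in\mathbb R$ let $\|x\|$ denote the distance from $x$ to the nearest integer. Let $\mathcal L(P)$ be the set of all values $$\limsup_{n\to\infty}\|x_n\|,\qquad x_n=\sum_{i:\,|\alpha_i|>1} g_i\,\alpha_i^n ,$$ where the coefficients $g_i\in\mathbb C$ run over all families such that $g_i\in\mathbb R$ if $\alpha_i\in\mathbb R$, and $g_j=\overline{g_i}$ if $\alpha_j=\overline{\alpha_i}$ (so that $x_n\in\mathbb R$). Put $$E(X)=\frac{1-(1-X)\prod_{m=0}^{\infty}(1-X^{2^m})}{2X},\qquad E^{(k)}(X)=\frac{1+X^{2^k}-(1-X)\prod_{m=0}^{k-1}(1-X^{2^m})}{2X(1+X^{2^k})}\quad(k\ge 0),$$ where the empty product is $1$, and $$E_d(X_1,\dots,X_d)=\sum_{i=1}^d\Bigl(\prod_{j\ne i}\frac{X_i}{X_i-X_j}\Bigr)E(X_i),\qquad E_d^{(k)}(X_1,\dots,X_d)=\sum_{i=1}^d\Bigl(\prod_{j\ne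 i}\frac{X_i}{X_i-X_j}\Bigr)E^{(k)}(X_i).$$ Assume that every $\alpha_j$ is real with $\alpha_j>1$, and that $\alpha_1^{-1}+\cdots+\alpha_d^{-1}\le \tfrac12$. Then $e:=|a_0|^{-1}E_d(\alpha_1^{-1},\dots,\alpha_d^{-1})$ is the minimal limit point (accumulation point) of $\mathcal L(P)$, and $$\mathcal L(P)\cap(0,e)=\Bigl\{\,|a_0|^{-1}E_d^{(k)}(\alpha_1^{-1},\dots,\alpha_d^{-1})\ :\ k=0,1,2,\dots\Bigr\}.$$ -/

import Mathlib

open Polynomial Filter Topology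
open scoped BigOperators ComplexConjugate

noncomputable section

namespace MarkoffLagrange

/-- Distance `‖x‖` from a real number to the nearest integer. -/
def distInt (x : ℝ) : ℝ := |x - round x|

/-- The expanding roots of `P`: its distinct complex roots of modulus greater than `1`. -/
def expandingRoots (P : ℤ[X]) : Finset ℂ :=
  (P.aroots ℂ).toFinset.filter fun z => 1 < ‖z‖

/-- The coefficient families `Ξ_k`: to every expanding root `z` a polynomial `g z` of degree at
most `k` is attached, and conjugate roots carry conjugate polynomials. (For a real root `z` the
second condition says that `g z` has real coefficients. The values of `g` away from the
expanding roots are irrelevant.) -/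
def coeffFamilies (k : ℕ) (P : ℤ[X]) : Set (ℂ → ℂ[X]) :=
  {g | ∀ z ∈ expandingRoots P,
    (g z).natDegree ≤ k ∧ g (conj z) = (g z).map (starRingEnd ℂ)}

/-- The linear recurrence `x_n(g) = ∑ g_i(n) α_i ^ n`, summed over the expanding roots `α_i`.
The sum is a real number for `g` in `Ξ_k`, which is why taking the real part loses nothing. -/
def recurrence (P : ℤ[X]) (g : ℂ → ℂ[X]) (n : ℤ) : ℝ :=
  (∑ z ∈ expandingRoots P, (g z).eval (n : ℂ) * z ^ n).re

/-- The set `L^(k)(P)` of all `limsup_{n → ∞} ‖x_n(g)‖` with `g` in `Ξ_k`. -/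
def spectrumOrder (k : ℕ) (P : ℤ[X]) : Set ℝ :=
  {x | ∃ g ∈ coeffFamilies k P,
    x = limsup (fun n : ℕ => distInt (recurrence P g (n : ℤ))) atTop}

/-- The spectrum `L(P) = L^(0)(P)`. -/
def spectrum (P : ℤ[X]) : Set ℝ := spectrumOrder 0 P

/-- `E(X) = (1 - (1 - X) ∏_{m ≥ 0} (1 - X^(2^m))) / (2X)`. -/
def E (x : ℝ) : ℝ := (1 - (1 - x) * ∏' m : ℕ, (1 - x ^ 2 ^ m)) / (2 * x)

/-- `E^(k)(X) = (1 + X^(2^k) - (1 - X) ∏_{0 ≤ m < k} (1 - X^(2^m))) / (2X (1 + X^(2^k)))`. -/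
def Efin (k : ℕ) (x : ℝ) : ℝ :=
  (1 + x ^ 2 ^ k - (1 - x) * ∏ m ∈ Finset.range k, (1 - x ^ 2 ^ m)) /
    (2 * x * (1 + x ^ 2 ^ k))

/-- `E_r(X_1, …, X_r) = ∑_i (∏_{j ≠ i} X_i / (X_i - X_j)) E(X_i)`. -/
def Emulti {r : ℕ} (x : Fin r → ℝ) : ℝ :=
  ∑ i, (∏ j ∈ Finset.univ.erase i, x i / (x i - x j)) * E (x i)

/-- `E_r^(k)(X_1, …, X_r) = ∑_i (∏_{j ≠ i} X_i / (X_i - X_j)) E^(k)(X_i)`. -/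
def EmultiFin (k : ℕ) {r : ℕ} (x : Fin r → ℝ) : ℝ :=
  ∑ i, (∏ j ∈ Finset.univ.erase i, x i / (x i - x j)) * Efin k (x i)

end MarkoffLagrange

end

/-!
Let `K` be the sequence of power series coefficients of `1 / ∏ (1 - X / α i)`. If `y` solves the
recurrence with characteristic polynomial `P`, then `P / a₀`, as a polynomial in the shift, maps
`a₀ (y n - round (y n))` to a sequence `t` of integers. On bounded sequences this operator is
inverted by correlation with `K`, so `|a₀| ‖y n‖ = |∑ k, K k * t (n + k)|`.

Since `∑ (α i)⁻¹ ≤ 1 / 2`, the terms of `K` at least halve at each step. Small values of the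
right-hand side therefore force `t` to take values in `{-1, 0, 1}` with nonzero terms of alternating
signs, i.e. `t n = b n - b (n + 1)` for a binary sequence `b`. Summation by parts turns the
correlation into a weighted digit sum of the tail of `b` at `n`, complemented so as to start
with `0`, and this sum is monotone for the lexicographic order.

A binary sequence whose normalized tails are all at most the Thue–Morse sequence is eventually
constant or eventually the image of another such sequence under `0 ↦ 01`, `1 ↦ 10`. Iterating this,
either `b` is eventually an iterated image of a constant sequence, and the limsup is the digit
sum of one of the periodic sequences approximating the Thue–Morse sequence from below, or the
normalized tails of `b` accumulate at the Thue–Morse sequence itself. The generating functions of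
these sequences factor as products of `1 - X ^ 2 ^ m`, and partial fractions for `K` give the
multivariate expressions.
-/

namespace MarkoffLagrange

section BinarySequences

variable {b c d e f : ℕ → Bool}

/-- The Thue–Morse substitution `0 ↦ 01`, `1 ↦ 10`, applied to a binary sequence. -/
def morse (c : ℕ → Bool) (n : ℕ) : Bool := xor (c (n / 2)) n.bodd

/-- The Thue–Morse sequence: `thueMorse n` is the parity of the binary digit sum of `n`. -/
def thueMorse (n : ℕ) : Bool := n.bits.foldr xor false

/-- The periodic sequence obtained by substituting `k` times in `000…`; these sequences
approximate the Thue–Morse sequence from below in the lexicographic order. -/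
def morsePeriodic (k : ℕ) : ℕ → Bool := morse^[k] fun _ => false

/-- The sequence `c` read from position `n` on, complemented if necessary so as to start
with `0`. -/
def normTail (c : ℕ → Bool) (n k : ℕ) : Bool := xor (c n) (c (n + k))

/-- `IsTail c b` says that deleting finitely many initial terms of `b` leaves `c`. -/
def IsTail (c b : ℕ → Bool) : Prop := ∃ M, ∀ i, b (M + i) = c i

/-- The sequences all of whose normalized tails are lexicographically at most the Thue–Morse
sequence. -/
def Admissible (b : ℕ → Bool) : Prop := ∀ n, toLex (normTail b n) ≤ toLex thueMorse

theorem toLex_lt_toLex_iff :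
    toLex e < toLex f ↔ ∃ p, (∀ i < p, e i = f i) ∧ e p = false ∧ f p = true :=
  exists_congr fun _ => and_congr_right fun _ => Bool.lt_iff

theorem eq_false_of_toLex_le {i : ℕ} (h : toLex e ≤ toLex f) (hlt : ∀ j < i, e j = f j)
    (hf : f i = false) : e i = false :=
  Bool.eq_false_of_le_false ((Pi.apply_le_of_toLex h hlt).trans_eq hf)

/-! ### The substitution -/

theorem morse_two_mul (c : ℕ → Bool) (n : ℕ) : morse c (2 * n) = c n := by
  simp [morse]

theorem morse_two_mul_add_one (c : ℕ → Bool) (n : ℕ) : morse c (2 * n + 1) = !c n := by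
  simp [morse, Nat.mul_add_div]

theorem eq_morse_iff : e = morse c ↔ ∀ n, e (2 * n) = c n ∧ e (2 * n + 1) = !c n := by
  refine ⟨?_, fun h => funext fun n => ?_⟩
  · rintro rfl n
    exact ⟨morse_two_mul c n, morse_two_mul_add_one c n⟩
  · obtain ⟨m, rfl | rfl⟩ := n.even_or_odd'
    · rw [morse_two_mul, (h m).1]
    · rw [morse_two_mul_add_one, (h m).2]

theorem morse_congr {m : ℕ} (h : ∀ i < m, e i = f i) :
    ∀ i < 2 * m, morse e i = morse f i := fun i hi => by
  rw [morse, morse, h (i / 2) (by omega)]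

theorem morse_iterate_congr {m : ℕ} (h : ∀ i < m, e i = f i) (k : ℕ) :
    ∀ i < 2 ^ k * m, morse^[k] e i = morse^[k] f i := by
  induction k with
  | zero => simpa using h
  | succ k ih =>
    rw [Function.iterate_succ_apply', Function.iterate_succ_apply', pow_succ', mul_assoc]
    exact morse_congr ih

theorem strictMono_morse :
    StrictMono fun e : Lex (ℕ → Bool) => toLex (morse (ofLex e)) := by
  intro e f hef
  obtain ⟨p, hlt, he, hf⟩ := toLex_lt_toLex_iff.1 hef
  exact toLex_lt_toLex_iff.2 ⟨2 * p, morse_congr hlt, (morse_two_mul _ p).trans he,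
    (morse_two_mul _ p).trans hf⟩

theorem toLex_morse_le_toLex_morse : toLex (morse e) ≤ toLex (morse f) ↔ toLex e ≤ toLex f :=
  strictMono_morse.le_iff_le

theorem toLex_morse_iterate_lt (h : toLex e < toLex f) (k : ℕ) :
    toLex (morse^[k] e) < toLex (morse^[k] f) := by
  induction k with
  | zero => exact h
  | succ k ih =>
    rw [Function.iterate_succ_apply', Function.iterate_succ_apply']
    exact strictMono_morse ih

theorem morse_iterate_xor (k : ℕ) (a : Bool) (c : ℕ → Bool) :
    morse^[k] (fun n => xor a (c n)) = fun n => xor a (morse^[k] c n) := by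
  induction k with
  | zero => rfl
  | succ k ih =>
    funext n
    rw [Function.iterate_succ_apply', Function.iterate_succ_apply', ih, morse, morse,
      Bool.xor_assoc]

theorem morse_iterate_apply_zero (k : ℕ) (c : ℕ → Bool) : morse^[k] c 0 = c 0 := by
  induction k with
  | zero => rfl
  | succ k ih => rw [Function.iterate_succ_apply', ← ih]; exact morse_two_mul _ 0

/-! ### The Thue–Morse sequence and its periodic approximations -/

theorem thueMorse_two_mul (n : ℕ) : thueMorse (2 * n) = thueMorse n := by
  obtain rfl | hn := eq_or_ne n 0
  · rfl
  · rw [thueMorse, Nat.bit0_bits n hn, List.foldr_cons, Bool.false_xor, thueMorse]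

theorem thueMorse_two_mul_add_one (n : ℕ) : thueMorse (2 * n + 1) = !thueMorse n := by
  rw [thueMorse, Nat.bit1_bits, List.foldr_cons, Bool.true_xor, thueMorse]

theorem morse_thueMorse : morse thueMorse = thueMorse :=
  (eq_morse_iff.2 fun n => ⟨thueMorse_two_mul n, thueMorse_two_mul_add_one n⟩).symm

theorem morse_iterate_thueMorse (k : ℕ) : morse^[k] thueMorse = thueMorse :=
  Function.iterate_fixed morse_thueMorse k

theorem thueMorse_zero : thueMorse 0 = false := rfl

theorem thueMorse_one : thueMorse 1 = true := by simp [thueMorse]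

theorem thueMorse_two_pow (k : ℕ) : thueMorse (2 ^ k) = true := by
  induction k with
  | zero => exact thueMorse_one
  | succ k ih => rw [pow_succ', thueMorse_two_mul, ih]

theorem morsePeriodic_succ (k : ℕ) : morsePeriodic (k + 1) = morse (morsePeriodic k) :=
  Function.iterate_succ_apply' _ _ _

theorem morsePeriodic_apply_zero (k : ℕ) : morsePeriodic k 0 = false :=
  morse_iterate_apply_zero k _

theorem morsePeriodic_succ_apply_one (k : ℕ) : morsePeriodic (k + 1) 1 = true := by
  rw [morsePeriodic_succ, ← zero_add 1, ← mul_zero 2, morse_two_mul_add_one,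
    morsePeriodic_apply_zero, Bool.not_false]

theorem morsePeriodic_lt_thueMorse (k : ℕ) : toLex (morsePeriodic k) < toLex thueMorse := by
  rw [← morse_iterate_thueMorse k]
  refine toLex_morse_iterate_lt (toLex_lt_toLex_iff.2 ⟨1, fun i hi => ?_, rfl, thueMorse_one⟩) k
  rw [Nat.lt_one_iff.1 hi, thueMorse_zero]

theorem tendsto_morsePeriodic : Tendsto morsePeriodic atTop (𝓝 thueMorse) := by
  refine tendsto_pi_nhds.2 fun i => tendsto_const_nhds.congr' ?_
  filter_upwards [eventually_ge_atTop i] with k hk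
  rw [← morse_iterate_thueMorse k]
  refine morse_iterate_congr (m := 1) (fun j hj => ?_) k i ?_
  · rw [Nat.lt_one_iff.1 hj, thueMorse_zero]
  · rw [mul_one]
    exact hk.trans_lt k.lt_two_pow_self

/-! ### Normalized tails -/

theorem normTail_apply_zero (c : ℕ → Bool) (n : ℕ) : normTail c n 0 = false := by
  simp [normTail]

theorem normTail_xor (a : Bool) (c : ℕ → Bool) : normTail (fun n => xor a (c n)) = normTail c := by
  funext n k
  simp only [normTail]
  cases a <;> simp

theorem normTail_morse_two_mul (c : ℕ → Bool) (n : ℕ) :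
    normTail (morse c) (2 * n) = morse (normTail c n) := by
  refine eq_morse_iff.2 fun m => ?_
  simp only [normTail]
  rw [← mul_add, ← add_assoc, ← mul_add]
  simp [morse_two_mul, morse_two_mul_add_one]

theorem normTail_morse_iterate (k : ℕ) (c : ℕ → Bool) (n : ℕ) :
    normTail (morse^[k] c) (2 ^ k * n) = morse^[k] (normTail c n) := by
  induction k with
  | zero => simp
  | succ k ih =>
    rw [Function.iterate_succ_apply', Function.iterate_succ_apply', pow_succ', mul_assoc,
      normTail_morse_two_mul, ih]

theorem normTail_morse_iterate_const (k : ℕ) (a : Bool) :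
    normTail (morse^[k] fun _ => a) = normTail (morsePeriodic k) := by
  rw [← normTail_xor a (morsePeriodic k), morsePeriodic, ← morse_iterate_xor]
  simp only [Bool.xor_false]

theorem normTail_morsePeriodic_two_pow_mul (k n : ℕ) :
    normTail (morsePeriodic k) (2 ^ k * n) = morsePeriodic k := by
  rw [morsePeriodic, normTail_morse_iterate]
  rfl

theorem toLex_normTail_morse_le (hc₀ : c 0 = false) (hc₁ : c 1 = true)
    (hc : ∀ n, toLex (normTail c n) ≤ toLex c) (n : ℕ) :
    toLex (normTail (morse c) n) ≤ toLex (morse c) := by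
  obtain ⟨m, rfl | rfl⟩ := n.even_or_odd'
  · rw [normTail_morse_two_mul, toLex_morse_le_toLex_morse]
    exact hc m
  · have head_zero : morse c 0 = false := by simp [morse, hc₀]
    have head_one : morse c 1 = true := by simp [morse, hc₀]
    have head_two : morse c 2 = true := by simp [morse, hc₁]
    have tail_one : normTail (morse c) (2 * m + 1) 1 = xor (!c m) (c (m + 1)) := by
      rw [normTail, morse_two_mul_add_one, show 2 * m + 1 + 1 = 2 * (m + 1) by ring, morse_two_mul]
    have tail_two : normTail (morse c) (2 * m + 1) 2 = xor (!c m) (!c (m + 1)) := by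
      rw [normTail, morse_two_mul_add_one, show 2 * m + 1 + 2 = 2 * (m + 1) + 1 by ring,
        morse_two_mul_add_one]
    refine le_of_lt (toLex_lt_toLex_iff.2 ?_)
    by_cases hm : c m = c (m + 1)
    · refine ⟨2, fun i hi => ?_, by simp [tail_two, hm], head_two⟩
      interval_cases i
      · rw [normTail_apply_zero, head_zero]
      · simp [tail_one, head_one, hm]
    · refine ⟨1, fun i hi => ?_, by simpa [tail_one] using hm, head_one⟩
      rw [Nat.lt_one_iff.1 hi, normTail_apply_zero, head_zero]

theorem toLex_normTail_morsePeriodic_le :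
    ∀ k n, toLex (normTail (morsePeriodic k) n) ≤ toLex (morsePeriodic k)
  | 0, n => le_of_eq (congrArg toLex (by simpa using normTail_morsePeriodic_two_pow_mul 0 n))
  | 1, n => by
    refine le_of_eq (congrArg toLex (funext fun i => ?_))
    simp only [morsePeriodic, Function.iterate_one, normTail, morse, Bool.false_xor, Nat.bodd_add]
    cases n.bodd <;> simp
  | k + 2, n => by
    rw [morsePeriodic_succ (k + 1)]
    exact toLex_normTail_morse_le (morsePeriodic_apply_zero _) (morsePeriodic_succ_apply_one k)
      (toLex_normTail_morsePeriodic_le (k + 1)) n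

/-! ### Tails and admissible sequences -/

theorem IsTail.trans (hdc : IsTail d c) (hcb : IsTail c b) : IsTail d b := by
  obtain ⟨M, hM⟩ := hdc
  obtain ⟨N, hN⟩ := hcb
  exact ⟨N + M, fun i => by rw [add_assoc, hN, hM]⟩

theorem IsTail.morse (h : IsTail c b) : IsTail (morse c) (morse b) := by
  obtain ⟨M, hM⟩ := h
  refine ⟨2 * M, congrFun (eq_morse_iff.2 fun n => ?_)⟩
  rw [← mul_add, ← add_assoc, ← mul_add, morse_two_mul, morse_two_mul_add_one, hM]
  exact ⟨rfl, rfl⟩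

theorem IsTail.morse_iterate (h : IsTail c b) (k : ℕ) :
    IsTail (MarkoffLagrange.morse^[k] c) (MarkoffLagrange.morse^[k] b) := by
  induction k with
  | zero => exact h
  | succ k ih =>
    rw [Function.iterate_succ_apply', Function.iterate_succ_apply']
    exact ih.morse

theorem IsTail.exists_normTail_eq (h : IsTail c b) :
    ∃ M, ∀ n, normTail b (M + n) = normTail c n := by
  obtain ⟨M, hM⟩ := h
  exact ⟨M, fun n => funext fun k => by rw [normTail, normTail, add_assoc, hM, hM]⟩

theorem exists_ne_succ_of_not_isTail_const (hb : ∀ a, ¬IsTail (fun _ => a) b) (M : ℕ) :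
    ∃ n ≥ M, b n ≠ b (n + 1) := by
  by_contra! h
  refine hb (b M) ⟨M, fun i => ?_⟩
  induction i with
  | zero => rfl
  | succ i ih => rw [← ih, ← add_assoc, h (M + i) (Nat.le_add_right M i)]

theorem isTail_morse_of_forall_ne {m : ℕ} (h : ∀ i, b (m + 2 * i) ≠ b (m + 2 * i + 1)) :
    IsTail (morse fun i => b (m + 2 * i)) b :=
  ⟨m, congrFun (eq_morse_iff.2 fun i => ⟨rfl, Bool.eq_not_of_ne (h i).symm⟩)⟩

theorem Admissible.of_isTail (hb : Admissible b) (h : IsTail c b) : Admissible c := by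
  obtain ⟨M, hM⟩ := h.exists_normTail_eq
  exact fun n => (hM n).symm ▸ hb (M + n)

theorem Admissible.of_morse (h : Admissible (morse c)) : Admissible c := fun n => by
  rw [← toLex_morse_le_toLex_morse, ← normTail_morse_two_mul, morse_thueMorse]
  exact h (2 * n)

-- The Thue–Morse sequence begins with `0110100`.
theorem digits_of_toLex_le_thueMorse (he : toLex e ≤ toLex thueMorse) (he₀ : e 0 = false)
    (he₁ : e 1 = true) (he₂ : e 2 = true) :
    e 3 = false ∧ (e 4 = true → e 5 = false ∧ e 6 = false) := by
  obtain ⟨t₂, t₃, t₄, t₅, t₆⟩ : thueMorse 2 = true ∧ thueMorse 3 = false ∧ thueMorse 4 = true ∧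
    thueMorse 5 = false ∧ thueMorse 6 = false := by decide
  have agree₃ : ∀ j < 3, e j = thueMorse j := by
    intro j hj
    interval_cases j
    exacts [he₀.trans thueMorse_zero.symm, he₁.trans thueMorse_one.symm, he₂.trans t₂.symm]
  have he₃ : e 3 = false := eq_false_of_toLex_le he agree₃ t₃
  refine ⟨he₃, fun he₄ => ?_⟩
  have agree₅ : ∀ j < 5, e j = thueMorse j := by
    simp only [Nat.forall_lt_succ_right (n := 4), Nat.forall_lt_succ_right (n := 3)]
    exact ⟨⟨agree₃, he₃.trans t₃.symm⟩, he₄.trans t₄.symm⟩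
  have he₅ : e 5 = false := eq_false_of_toLex_le he agree₅ t₅
  have agree₆ : ∀ j < 6, e j = thueMorse j :=
    Nat.forall_lt_succ_right.2 ⟨agree₅, he₅.trans t₅.symm⟩
  exact ⟨he₅, eq_false_of_toLex_le he agree₆ t₆⟩

theorem Admissible.after_zero_one_one {m : ℕ} (hb : Admissible b) (h₁ : b m ≠ b (m + 1))
    (h₂ : b (m + 1) = b (m + 2)) :
    b (m + 2) ≠ b (m + 3) ∧
      (b (m + 3) = b (m + 4) ∨ b (m + 4) ≠ b (m + 5) ∧ b (m + 5) = b (m + 6)) := by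
  have digits := digits_of_toLex_le_thueMorse (hb m) (normTail_apply_zero b m)
    (by simpa [normTail] using h₁) (by simpa [normTail, ← h₂] using h₁)
  simp only [normTail] at digits
  revert digits h₁ h₂
  generalize b m = x₀, b (m + 1) = x₁, b (m + 2) = x₂, b (m + 3) = x₃, b (m + 4) = x₄,
    b (m + 5) = x₅, b (m + 6) = x₆
  revert x₀ x₁ x₂ x₃ x₄ x₅ x₆
  decide

-- Each occurrence of `011` (or `100`) is followed, two or four places later, by another one, so
-- from the first occurrence on the sequence splits into pairs of distinct digits.
theorem Admissible.forall_ne_of_zero_one_one {m : ℕ} (hb : Admissible b) (h₁ : b m ≠ b (m + 1))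
    (h₂ : b (m + 1) = b (m + 2)) (i : ℕ) : b (m + 2 * i) ≠ b (m + 2 * i + 1) := by
  suffices h : b (m + 2 * i) ≠ b (m + 2 * i + 1) ∧
      (b (m + 2 * i + 1) = b (m + 2 * i + 2) ∨
        b (m + 2 * i + 2) ≠ b (m + 2 * i + 3) ∧ b (m + 2 * i + 3) = b (m + 2 * i + 4)) from h.1
  induction i with
  | zero => exact ⟨h₁, Or.inl h₂⟩
  | succ i ih =>
    rw [Nat.mul_succ, ← add_assoc]
    obtain ⟨pair, heq | ⟨next_pair, heq⟩⟩ := ih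
    · exact hb.after_zero_one_one pair heq
    · exact ⟨next_pair, Or.inl heq⟩

theorem Admissible.exists_isTail_morse (hb : Admissible b) (hconst : ∀ a, ¬IsTail (fun _ => a) b) :
    ∃ c, IsTail (MarkoffLagrange.morse c) b := by
  by_cases hrep : ∃ m, b m ≠ b (m + 1) ∧ b (m + 1) = b (m + 2)
  · obtain ⟨m, h₁, h₂⟩ := hrep
    exact ⟨_, isTail_morse_of_forall_ne (hb.forall_ne_of_zero_one_one h₁ h₂)⟩
  · push Not at hrep
    obtain ⟨m, -, hm⟩ := exists_ne_succ_of_not_isTail_const hconst 0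
    have alternating : ∀ i, b (m + i) ≠ b (m + i + 1) := by
      intro i
      induction i with
      | zero => exact hm
      | succ i ih => exact hrep (m + i) ih
    exact ⟨_, isTail_morse_of_forall_ne fun i => alternating (2 * i)⟩

theorem Admissible.exists_isTail_morse_iterate (hb : Admissible b)
    (hconst : ∀ k a, ¬IsTail (MarkoffLagrange.morse^[k] fun _ => a) b) (k : ℕ) :
    ∃ c, Admissible c ∧ IsTail (MarkoffLagrange.morse^[k] c) b := by
  induction k with
  | zero => exact ⟨b, hb, 0, fun i => by simp⟩
  | succ k ih =>
    obtain ⟨c, hc, hcb⟩ := ih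
    obtain ⟨c', hc'⟩ := hc.exists_isTail_morse fun a ha =>
      hconst k a ((ha.morse_iterate k).trans hcb)
    exact ⟨c', (hc.of_isTail hc').of_morse, (hc'.morse_iterate k).trans hcb⟩

theorem Admissible.exists_normTail_eq_thueMorse (hb : Admissible b)
    (hconst : ∀ k a, ¬IsTail (MarkoffLagrange.morse^[k] fun _ => a) b) (k : ℕ) :
    ∃ n ≥ k, ∀ i < 2 ^ (k + 1), normTail b n i = thueMorse i := by
  obtain ⟨c, -, hcb⟩ := hb.exists_isTail_morse_iterate hconst k
  obtain ⟨M, hM⟩ := hcb.exists_normTail_eq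
  obtain ⟨n, hn, hne⟩ := exists_ne_succ_of_not_isTail_const
    (fun a ha => hconst k a ((ha.morse_iterate k).trans hcb)) k
  have hkn : k ≤ 2 ^ k * n := hn.trans (Nat.le_mul_of_pos_left n (by positivity))
  refine ⟨M + 2 ^ k * n, hkn.trans (Nat.le_add_left _ M), ?_⟩
  rw [hM, normTail_morse_iterate, ← morse_iterate_thueMorse k, pow_succ]
  refine morse_iterate_congr (fun i hi => ?_) k
  interval_cases i
  · rw [normTail_apply_zero, thueMorse_zero]
  · simpa [normTail, thueMorse_one] using hne

theorem Admissible.isTail_or_mapClusterPt (hb : Admissible b) :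
    (∃ k a, IsTail (MarkoffLagrange.morse^[k] fun _ => a) b) ∨
      MapClusterPt thueMorse atTop (normTail b) := by
  rw [or_iff_not_imp_left]
  intro hconst
  push Not at hconst
  choose φ hφ_le hφ using hb.exists_normTail_eq_thueMorse hconst
  have tendsto_normTail : Tendsto (normTail b ∘ φ) atTop (𝓝 thueMorse) := by
    refine tendsto_pi_nhds.2 fun i => tendsto_const_nhds.congr' ?_
    filter_upwards [eventually_ge_atTop i] with k hk
    exact (hφ k i (hk.trans_lt (k.lt_two_pow_self.trans (Nat.pow_lt_pow_succ one_lt_two)))).symm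
  exact tendsto_normTail.mapClusterPt.of_comp (tendsto_atTop_mono hφ_le tendsto_id)

end BinarySequences

/-! ### Lexicographically monotone digit sums -/

section Weights

variable {q : ℕ → ℝ} {b e f : ℕ → Bool}

/-- Positive summable weights each of which dominates the sum of all later ones, so that the
weighted digit sum `wsum` is monotone for the lexicographic order. -/
structure IsWeight (q : ℕ → ℝ) : Prop where
  pos : ∀ k, 0 < q k
  summable : Summable q
  tail_le : ∀ k, ∑' j, q (j + (k + 1)) ≤ q k

/-- The weighted sum of the digits of a binary sequence. The digit at position `0` is left out: it
vanishes for all normalized tails. -/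
noncomputable def wsum (q : ℕ → ℝ) (e : ℕ → Bool) : ℝ := ∑' k, q k * (e (k + 1)).toNat

theorem mul_toNat_le {r : ℝ} (hr : 0 ≤ r) (a : Bool) : r * a.toNat ≤ r :=
  mul_le_of_le_one_right hr (by exact_mod_cast a.toNat_le)

theorem continuous_wsum (hq : IsWeight q) : Continuous (wsum q) := by
  refine continuous_tsum (fun k => ?_) hq.summable fun k e => ?_
  · have continuous_toNat : Continuous fun a : Bool => (a.toNat : ℝ) :=
      continuous_of_discreteTopology
    exact continuous_const.mul (continuous_toNat.comp (continuous_apply (k + 1)))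
  · have hk := (hq.pos k).le
    rw [Real.norm_of_nonneg (by positivity)]
    exact mul_toNat_le hk _

theorem IsWeight.summable_mul_toNat (hq : IsWeight q) (e : ℕ → Bool) :
    Summable fun k => q k * (e (k + 1)).toNat :=
  hq.summable.of_nonneg_of_le (fun k => mul_nonneg (hq.pos k).le (Nat.cast_nonneg _))
    fun k => mul_toNat_le (hq.pos k).le _

theorem IsWeight.wsum_nonneg (hq : IsWeight q) (e : ℕ → Bool) : 0 ≤ wsum q e :=
  tsum_nonneg fun k => mul_nonneg (hq.pos k).le (Nat.cast_nonneg _)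

theorem IsWeight.wsum_le_tsum (hq : IsWeight q) (e : ℕ → Bool) : wsum q e ≤ ∑' k, q k :=
  (hq.summable_mul_toNat e).tsum_le_tsum (fun k => mul_toNat_le (hq.pos k).le _) hq.summable

theorem IsWeight.wsum_add_tail_le (hq : IsWeight q) {m : ℕ} (hlt : ∀ i < m + 1, e i = f i)
    (he : e (m + 1) = false) (hf : f (m + 1) = true) :
    wsum q e + ∑' j, q (j + (m + 1)) * (f (j + (m + 1) + 1)).toNat ≤ wsum q f := by
  have tail_e : ∑' j, q (j + (m + 1)) * (e (j + (m + 1) + 1)).toNat ≤ q m :=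
    (((summable_nat_add_iff (m + 1)).2 (hq.summable_mul_toNat e)).tsum_le_tsum
      (fun j => mul_toNat_le (hq.pos _).le _) ((summable_nat_add_iff (m + 1)).2 hq.summable)).trans
      (hq.tail_le m)
  have heads : ∑ k ∈ Finset.range m, q k * ((e (k + 1)).toNat : ℝ) =
      ∑ k ∈ Finset.range m, q k * (f (k + 1)).toNat :=
    Finset.sum_congr rfl fun k hk => by rw [hlt (k + 1) (by simpa using hk)]
  rw [wsum, wsum, ← (hq.summable_mul_toNat e).sum_add_tsum_nat_add (m + 1),
    ← (hq.summable_mul_toNat f).sum_add_tsum_nat_add (m + 1), Finset.sum_range_succ,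
    Finset.sum_range_succ, heads, he, hf]
  simp only [Bool.toNat_false, Bool.toNat_true, Nat.cast_zero, Nat.cast_one, mul_zero, mul_one]
  linarith

theorem IsWeight.wsum_le_wsum (hq : IsWeight q) (h : toLex e ≤ toLex f) (hf : f 0 = false) :
    wsum q e ≤ wsum q f := by
  obtain heq | hlt := h.eq_or_lt
  · rw [toLex_inj.1 heq]
  obtain ⟨_ | m, hm, he, hf'⟩ := toLex_lt_toLex_iff.1 hlt
  · simp [hf] at hf'
  · refine le_trans (le_add_of_nonneg_right ?_) (hq.wsum_add_tail_le hm he hf')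
    exact tsum_nonneg fun j => mul_nonneg (hq.pos _).le (Nat.cast_nonneg _)

theorem IsWeight.wsum_lt_wsum (hq : IsWeight q) (h : toLex e < toLex f) (hf : f 0 = false)
    (hf_freq : ∃ᶠ n in atTop, f n = true) : wsum q e < wsum q f := by
  obtain ⟨_ | m, hm, he, hf'⟩ := toLex_lt_toLex_iff.1 h
  · simp [hf] at hf'
  · obtain ⟨n, hn, hfn⟩ := frequently_atTop.1 hf_freq (m + 1 + 1)
    obtain ⟨j, rfl⟩ := Nat.exists_eq_add_of_le' hn
    refine (lt_add_of_pos_right _ ?_).trans_le (hq.wsum_add_tail_le hm he hf')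
    refine ((summable_nat_add_iff (m + 1)).2 (hq.summable_mul_toNat f)).tsum_pos
      (fun j => mul_nonneg (hq.pos _).le (Nat.cast_nonneg _)) j ?_
    simpa [add_assoc, hfn] using hq.pos _

theorem wsum_morsePeriodic_zero (q : ℕ → ℝ) : wsum q (morsePeriodic 0) = 0 := by
  simp [wsum, morsePeriodic]

theorem IsWeight.wsum_morsePeriodic_succ_pos (hq : IsWeight q) (k : ℕ) :
    0 < wsum q (morsePeriodic (k + 1)) :=
  (hq.summable_mul_toNat _).tsum_pos (fun j => mul_nonneg (hq.pos j).le (Nat.cast_nonneg _)) 0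
    (by simp [morsePeriodic_succ_apply_one, hq.pos 0])

theorem IsWeight.wsum_morsePeriodic_lt (hq : IsWeight q) (k : ℕ) :
    wsum q (morsePeriodic k) < wsum q thueMorse := by
  refine hq.wsum_lt_wsum (morsePeriodic_lt_thueMorse k) thueMorse_zero ?_
  exact frequently_atTop.2 fun n => ⟨2 ^ n, n.lt_two_pow_self.le, thueMorse_two_pow n⟩

theorem IsWeight.tendsto_wsum_morsePeriodic (hq : IsWeight q) :
    Tendsto (fun k => wsum q (morsePeriodic k)) atTop (𝓝 (wsum q thueMorse)) :=
  ((continuous_wsum hq).tendsto thueMorse).comp tendsto_morsePeriodic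

theorem limsup_eq_of_eventually_le_of_frequently_eq {ι X : Type*}
    [ConditionallyCompleteLinearOrder X] {l : Filter ι} {u : ι → X} {a : X}
    (hle : ∀ᶠ n in l, u n ≤ a) (heq : ∃ᶠ n in l, u n = a) : limsup u l = a := by
  have hge : ∃ᶠ n in l, a ≤ u n := heq.mono fun n h => h.ge
  exact le_antisymm (limsup_le_of_le (IsCoboundedUnder.of_frequently_ge hge) hle)
    (le_limsup_of_frequently_le hge (isBoundedUnder_of_eventually_le hle))

theorem IsWeight.limsup_wsum_normTail_of_isTail (hq : IsWeight q) {k : ℕ} {a : Bool}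
    (h : IsTail (morse^[k] fun _ => a) b) :
    limsup (fun n => wsum q (normTail b n)) atTop = wsum q (morsePeriodic k) := by
  obtain ⟨M, hM⟩ := h.exists_normTail_eq
  rw [normTail_morse_iterate_const] at hM
  refine limsup_eq_of_eventually_le_of_frequently_eq ?_ (frequently_atTop.2 fun n => ?_)
  · filter_upwards [eventually_ge_atTop M] with n hn
    obtain ⟨i, rfl⟩ := Nat.exists_eq_add_of_le hn
    rw [hM]
    exact hq.wsum_le_wsum (toLex_normTail_morsePeriodic_le k i) (morsePeriodic_apply_zero k)
  · refine ⟨M + 2 ^ k * n, ?_, by rw [hM, normTail_morsePeriodic_two_pow_mul]⟩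
    exact (Nat.le_mul_of_pos_left n (by positivity)).trans (Nat.le_add_left _ _)

theorem IsWeight.limsup_wsum_normTail_morsePeriodic (hq : IsWeight q) (k : ℕ) :
    limsup (fun n => wsum q (normTail (morsePeriodic k) n)) atTop = wsum q (morsePeriodic k) :=
  hq.limsup_wsum_normTail_of_isTail ⟨0, fun i => by rw [zero_add, morsePeriodic]⟩

theorem IsWeight.exists_limsup_wsum_normTail_eq (hq : IsWeight q) {M : ℝ}
    (hM : M < wsum q thueMorse) (hb : ∀ n, wsum q (normTail b n) ≤ M) :
    ∃ k, limsup (fun n => wsum q (normTail b n)) atTop = wsum q (morsePeriodic k) := by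
  have admissible : Admissible b := fun n => le_of_not_gt fun hlt => hM.not_ge <|
    (hq.wsum_le_wsum hlt.le (normTail_apply_zero b n)).trans (hb n)
  obtain ⟨k, a, htail⟩ | hcluster := admissible.isTail_or_mapClusterPt
  · exact ⟨k, hq.limsup_wsum_normTail_of_isTail htail⟩
  · obtain ⟨n, hn⟩ := ((hcluster.continuousAt_comp (continuous_wsum hq).continuousAt).frequently
      (Ioi_mem_nhds hM)).exists
    exact absurd hn (hb n).not_gt

end Weights

/-! ### Halving kernels -/

section Kernels

variable {h : ℕ → ℝ} {t : ℕ → ℤ}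

/-- Positive sequences starting with `1` whose terms are at least halved at each step. -/
structure IsHalvingKernel (h : ℕ → ℝ) : Prop where
  zero : h 0 = 1
  pos : ∀ k, 0 < h k
  succ_le : ∀ k, h (k + 1) ≤ h k / 2

/-- The one-sided correlation of a kernel with a sequence. -/
noncomputable def corr (h y : ℕ → ℝ) (n : ℕ) : ℝ := ∑' k, h k * y (n + k)

/-- The successive decrements of a kernel; for a halving kernel they are the weights that appear
on summation by parts. -/
def decrement (h : ℕ → ℝ) (k : ℕ) : ℝ := h k - h (k + 1)

/-- The sequence of differences `b n - b (n + 1)` of the digits of a binary sequence. -/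
def digitDiff (b : ℕ → Bool) (n : ℕ) : ℤ := (b n).toNat - (b (n + 1)).toNat

theorem tsum_decrement_add (hh : Summable h) (m : ℕ) : ∑' j, decrement h (j + m) = h m := by
  have hm : Summable fun j => h (j + m) := (summable_nat_add_iff m).2 hh
  simp only [decrement, add_right_comm _ m 1]
  rw [hm.tsum_sub ((summable_nat_add_iff 1).2 hm), hm.tsum_eq_zero_add, zero_add,
    add_sub_cancel_right]

namespace IsHalvingKernel

theorem le_geometric (hh : IsHalvingKernel h) (m j : ℕ) :
    h (j + (m + 1)) ≤ h m / 2 / 2 ^ j := by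
  induction j with
  | zero => simpa using hh.succ_le m
  | succ j ih =>
    rw [add_right_comm, pow_succ, ← div_div]
    exact (hh.succ_le _).trans (by gcongr)

theorem summable (hh : IsHalvingKernel h) : Summable h :=
  (summable_nat_add_iff 1).1 ((summable_geometric_two' (h 0)).of_nonneg_of_le
    (fun _ => (hh.pos _).le) (hh.le_geometric 0))

theorem tail_le (hh : IsHalvingKernel h) (m : ℕ) : ∑' j, h (j + (m + 1)) ≤ h m := by
  rw [← tsum_geometric_two' (h m)]
  exact ((summable_nat_add_iff _).2 hh.summable).tsum_le_tsum (hh.le_geometric m)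
    (summable_geometric_two' (h m))

theorem isWeight_decrement (hh : IsHalvingKernel h) : IsWeight (decrement h) where
  pos k := by
    rw [decrement]
    linarith [hh.succ_le k, hh.pos k]
  summable := hh.summable.sub ((summable_nat_add_iff 1).2 hh.summable)
  tail_le k := by
    rw [tsum_decrement_add hh.summable, decrement]
    linarith [hh.succ_le k]

theorem wsum_decrement_le_one (hh : IsHalvingKernel h) (e : ℕ → Bool) :
    wsum (decrement h) e ≤ 1 := by
  rw [← hh.zero, ← tsum_decrement_add hh.summable 0]
  exact hh.isWeight_decrement.wsum_le_tsum e

theorem tsum_mul_toNat_sub (hh : IsHalvingKernel h) {e : ℕ → Bool} (he : e 0 = false) :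
    ∑' k, h k * (((e (k + 1)).toNat : ℝ) - (e k).toNat) = wsum (decrement h) e := by
  have summable_mul (a : ℕ → Bool) : Summable fun k => h k * ((a k).toNat : ℝ) :=
    hh.summable.of_nonneg_of_le (fun k => mul_nonneg (hh.pos k).le (Nat.cast_nonneg _))
      fun k => mul_toNat_le (hh.pos k).le _
  have summable_succ := summable_mul fun k => e (k + 1)
  simp only [wsum, decrement, mul_sub, sub_mul]
  rw [summable_succ.tsum_sub (summable_mul e), (summable_mul e).tsum_eq_zero_add, he,
    summable_succ.tsum_sub ((summable_nat_add_iff 1).2 (summable_mul e))]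
  simp

theorem abs_corr_digitDiff (hh : IsHalvingKernel h) (b : ℕ → Bool) (n : ℕ) :
    |corr h (fun i => (digitDiff b i : ℝ)) n| = wsum (decrement h) (normTail b n) := by
  have sign : ∀ k, (digitDiff b (n + k) : ℝ) = (if b n then 1 else -1) *
      (((normTail b n (k + 1)).toNat : ℝ) - (normTail b n k).toNat) := by
    intro k
    simp only [digitDiff, normTail, add_assoc]
    cases b n <;> cases b (n + k) <;> cases b (n + (k + 1)) <;> simp
  simp only [corr, sign, mul_left_comm (h _)]
  rw [tsum_mul_left, hh.tsum_mul_toNat_sub (normTail_apply_zero b n), abs_mul,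
    abs_of_nonneg (hh.isWeight_decrement.wsum_nonneg _)]
  cases b n <;> simp

theorem one_le_tsum (hh : IsHalvingKernel h) {y : ℕ → ℝ} {r : ℕ} (hy : ∀ k, |y k| ≤ 1)
    (hr : 0 < r) (hy₀ : y 0 = 1) (hy_mid : ∀ k, 0 < k → k < r → y k = 0) (hyr : y r = 1) :
    1 ≤ ∑' k, h k * y k := by
  have hs : Summable fun k => h k * y k := by
    refine hh.summable.of_norm_bounded fun k => ?_
    rw [norm_mul, Real.norm_of_nonneg (hh.pos k).le]
    exact mul_le_of_le_one_right (hh.pos k).le (hy k)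
  have head : ∑ k ∈ Finset.range r, h k * y k = 1 := by
    rw [Finset.sum_eq_single_of_mem 0 (Finset.mem_range.2 hr), hh.zero, hy₀, mul_one]
    intro k hk hk₀
    rw [hy_mid k (Nat.pos_of_ne_zero hk₀) (Finset.mem_range.1 hk), mul_zero]
  have tail : -h r ≤ ∑' j, h (j + (r + 1)) * y (j + (r + 1)) := by
    refine (neg_le_neg (hh.tail_le r)).trans ?_
    rw [← tsum_neg]
    refine ((summable_nat_add_iff (r + 1)).2 hh.summable).neg.tsum_le_tsum (fun j => ?_)
      ((summable_nat_add_iff (r + 1)).2 hs)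
    nlinarith [hh.pos (j + (r + 1)), (abs_le.1 (hy (j + (r + 1)))).1]
  rw [← hs.sum_add_tsum_nat_add (r + 1), Finset.sum_range_succ, head, hyr]
  linarith

theorem eq_neg_of_consecutive (hh : IsHalvingKernel h) {n m : ℕ} (ht : ∀ i, |t i| ≤ 1)
    (hcorr : |corr h (fun i => (t i : ℝ)) n| < 1) (hnm : n < m)
    (hn : t n ≠ 0) (hm : t m ≠ 0) (hmid : ∀ i, n < i → i < m → t i = 0) : t m = -t n := by
  have htn := abs_le.1 (ht n)
  have htm := abs_le.1 (ht m)
  by_contra hne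
  have heq : t m = t n := by omega
  have abs_tn : |(t n : ℝ)| = 1 := by
    obtain hn | hn : t n = 1 ∨ t n = -1 := by omega
    all_goals simp [hn]
  have sq_tn : (t n : ℝ) * t n = 1 := by rw [← abs_mul_abs_self, abs_tn, mul_one]
  obtain ⟨r, rfl⟩ := Nat.exists_eq_add_of_le hnm.le
  have one_le : 1 ≤ ∑' k, h k * ((t n : ℝ) * t (n + k)) := by
    refine hh.one_le_tsum (r := r) (fun k => ?_) (by omega) sq_tn (fun k hk hkr => ?_)
      (by rw [heq, sq_tn])
    · rw [abs_mul, abs_tn, one_mul]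
      exact_mod_cast ht (n + k)
    · rw [hmid (n + k) (by omega) (by omega), Int.cast_zero, mul_zero]
  simp only [mul_left_comm (h _)] at one_le
  rw [tsum_mul_left] at one_le
  refine hcorr.not_ge (one_le.trans ((le_abs_self _).trans_eq ?_))
  rw [abs_mul, abs_tn, one_mul, corr]

end IsHalvingKernel

theorem exists_eq_digitDiff_of_alternating (ht : ∀ n, |t n| ≤ 1)
    (halt : ∀ n m, n < m → t n ≠ 0 → t m ≠ 0 → (∀ i, n < i → i < m → t i = 0) → t m = -t n) :
    ∃ b, t = digitDiff b := by
  classical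
  let b : ℕ → Bool := Nat.rec (decide (∃ m, t m = 1 ∧ ∀ i < m, t i = 0))
    fun n bn => if t n = 0 then bn else decide (t n = -1)
  have b_succ : ∀ n, b (n + 1) = if t n = 0 then b n else decide (t n = -1) := fun _ => rfl
  have next_nonzero : ∀ n m, n ≤ m → t m ≠ 0 → (∀ i, n ≤ i → i < m → t i = 0) →
      b n = decide (t m = 1) := by
    intro n
    induction n with
    | zero =>
      refine fun m _ hm hz => decide_eq_decide.2 ⟨?_, fun hm₁ => ⟨m, hm₁, fun i => hz i i.zero_le⟩⟩
      rintro ⟨m', hm', hz'⟩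
      obtain hlt | rfl | hlt := lt_trichotomy m m'
      · exact absurd (hz' m hlt) hm
      · exact hm'
      · simp [hz m' m'.zero_le hlt] at hm'
    | succ n ih =>
      intro m hnm hm hz
      rw [b_succ]
      split_ifs with hn
      · refine ih m (by omega) hm fun i hi him => ?_
        obtain rfl | hi := hi.eq_or_lt
        exacts [hn, hz i hi him]
      · rw [halt n m hnm hn hm fun i hi => hz i hi, decide_eq_decide]
        omega
  refine ⟨b, funext fun n => ?_⟩
  rw [digitDiff, b_succ]
  split_ifs with hn
  · rw [hn, sub_self]
  · rw [next_nonzero n n le_rfl hn fun i hi hin => absurd hin hi.not_gt]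
    have := abs_le.1 (ht n)
    obtain hn | hn : t n = 1 ∨ t n = -1 := by omega
    all_goals simp [hn]

theorem IsHalvingKernel.exists_limsup_abs_corr_eq (hh : IsHalvingKernel h) {M : ℝ}
    (hM : M < wsum (decrement h) thueMorse) (ht : ∀ n, |t n| ≤ 1)
    (hcorr : ∀ n, |corr h (fun i => (t i : ℝ)) n| ≤ M) :
    ∃ k, limsup (fun n => |corr h (fun i => (t i : ℝ)) n|) atTop =
      wsum (decrement h) (morsePeriodic k) := by
  have hM₁ : M < 1 := hM.trans_le (hh.wsum_decrement_le_one _)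
  obtain ⟨b, rfl⟩ := exists_eq_digitDiff_of_alternating ht fun n m =>
    hh.eq_neg_of_consecutive ht ((hcorr n).trans_lt hM₁)
  simp only [hh.abs_corr_digitDiff] at hcorr ⊢
  exact hh.isWeight_decrement.exists_limsup_wsum_normTail_eq hM hcorr

theorem IsHalvingKernel.limsup_abs_corr_morsePeriodic (hh : IsHalvingKernel h) (k : ℕ) :
    limsup (fun n => |corr h (fun i => (digitDiff (morsePeriodic k) i : ℝ)) n|) atTop =
      wsum (decrement h) (morsePeriodic k) := by
  simp only [hh.abs_corr_digitDiff]
  exact hh.isWeight_decrement.limsup_wsum_normTail_morsePeriodic k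

theorem IsHalvingKernel.abs_corr_digitDiff_le_one (hh : IsHalvingKernel h) (b : ℕ → Bool) (n : ℕ) :
    |corr h (fun i => (digitDiff b i : ℝ)) n| ≤ 1 := by
  rw [hh.abs_corr_digitDiff]
  exact hh.wsum_decrement_le_one _

end Kernels

/-! ### Inverting the recurrence on bounded sequences -/

section Shift

variable {R : Type*} [CommRing R]

/-- The shift operator `y ↦ (n ↦ y (n + 1))`, so that `aeval (shift R) p y = 0` is the linear
recurrence with characteristic polynomial `p`. -/
def shift (R : Type*) [CommRing R] : Module.End R (ℕ → R) := LinearMap.funLeft R R Nat.succ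

theorem shift_pow_apply (j : ℕ) (y : ℕ → R) (n : ℕ) : (shift R ^ j) y n = y (n + j) := by
  induction j generalizing n with
  | zero => rfl
  | succ j ih =>
    rw [pow_succ', Module.End.mul_apply]
    exact (ih (n + 1)).trans (congrArg y (Nat.add_right_comm n 1 j))

theorem aeval_shift_apply (p : R[X]) (y : ℕ → R) (n : ℕ) :
    aeval (shift R) p y n = ∑ j ∈ Finset.range (p.natDegree + 1), p.coeff j * y (n + j) := by
  rw [aeval_eq_sum_range, LinearMap.sum_apply, Finset.sum_apply]
  exact Finset.sum_congr rfl fun j _ => by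
    rw [LinearMap.smul_apply, Pi.smul_apply, shift_pow_apply, smul_eq_mul]

theorem aeval_shift_one_sub_C_mul_X (b : R) (y : ℕ → R) (n : ℕ) :
    aeval (shift R) (1 - C b * X) y n = y n - b * y (n + 1) := by
  simp only [map_sub, map_one, map_mul, aeval_C, aeval_X, LinearMap.sub_apply, Pi.sub_apply,
    Module.End.one_apply, Module.End.mul_apply, Module.algebraMap_end_apply, Pi.smul_apply,
    smul_eq_mul]
  rfl

theorem aeval_shift_pow (p : R[X]) (g a : R) :
    aeval (shift R) p (fun n => g * a ^ n) = fun n => p.eval a * (g * a ^ n) := by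
  funext n
  rw [aeval_shift_apply, eval_eq_sum_range, Finset.sum_mul]
  exact Finset.sum_congr rfl fun j _ => by ring

end Shift

section PartialFractions

variable {ι K : Type*} [Field K] {β : ι → K} {s : Finset ι}

/-- The reciprocal polynomial of `∏ (X - β i)`. -/
noncomputable def recipPoly (β : ι → K) (s : Finset ι) : K[X] := ∏ i ∈ s, (1 - C (β i) * X)

theorem eval_zero_recipPoly (β : ι → K) (s : Finset ι) : (recipPoly β s).eval 0 = 1 := by
  simp [recipPoly, eval_prod]

theorem eval_inv_recipPoly {i : ι} (hi : i ∈ s) (hβ : β i ≠ 0) :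
    (recipPoly β s).eval (β i)⁻¹ = 0 := by
  rw [recipPoly, eval_prod]
  exact Finset.prod_eq_zero hi (by simp [hβ])

theorem aeval_recipPoly_sum_pow (hβ : ∀ i ∈ s, β i ≠ 0) (g : ι → K) :
    aeval (shift K) (recipPoly β s) (fun n => ∑ i ∈ s, g i * (β i)⁻¹ ^ n) = 0 := by
  have sum_fun : (fun n => ∑ i ∈ s, g i * (β i)⁻¹ ^ n) =
      ∑ i ∈ s, fun n => g i * (β i)⁻¹ ^ n := by
    funext n
    rw [Finset.sum_apply]
  rw [sum_fun, map_sum]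
  refine Finset.sum_eq_zero fun i hi => ?_
  rw [aeval_shift_pow, eval_inv_recipPoly hi (hβ i hi)]
  simp only [zero_mul]
  rfl

variable [DecidableEq ι]

/-- The coefficient of `1 / (1 - β i X)` in the partial fraction expansion of
`1 / recipPoly β s`. -/
def pfCoeff (β : ι → K) (s : Finset ι) (i : ι) : K := ∏ j ∈ s.erase i, β i / (β i - β j)

/-- The power series coefficients of `1 / recipPoly β s`, that is, the complete homogeneous
symmetric polynomials in the `β i`, written by partial fractions. -/
def pfKernel (β : ι → K) (s : Finset ι) (k : ℕ) : K := ∑ i ∈ s, pfCoeff β s i * β i ^ k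

theorem recipPoly_eq_mul_erase {i : ι} (hi : i ∈ s) :
    recipPoly β s = (1 - C (β i) * X) * recipPoly β (s.erase i) :=
  (Finset.mul_prod_erase s _ hi).symm

theorem C_pfCoeff_mul_recipPoly_erase (hβ : ∀ i ∈ s, β i ≠ 0) {i : ι} (hi : i ∈ s) :
    C (pfCoeff β s i) * recipPoly β (s.erase i) = Lagrange.basis s (fun i => (β i)⁻¹) i := by
  rw [pfCoeff, recipPoly, map_prod, ← Finset.prod_mul_distrib, Lagrange.basis]
  refine Finset.prod_congr rfl fun j hj => ?_
  have hj := Finset.mem_of_mem_erase hj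
  have node_sub : ((β i)⁻¹ - (β j)⁻¹)⁻¹ = -(β i / (β i - β j)) * β j := by
    rw [inv_sub_inv (hβ i hi) (hβ j hj), inv_div, ← neg_sub (β i), div_neg]
    ring
  have mul_inv : C (β j) * C (β j)⁻¹ = (1 : K[X]) := by
    rw [← C_mul, mul_inv_cancel₀ (hβ j hj), C_1]
  rw [Lagrange.basisDivisor, node_sub, C_mul, C_neg]
  linear_combination -C (β i / (β i - β j)) * mul_inv

theorem sum_C_pfCoeff_mul_recipPoly_erase (hβ : ∀ i ∈ s, β i ≠ 0) (hinj : Set.InjOn β s)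
    (hs : s.Nonempty) : ∑ i ∈ s, C (pfCoeff β s i) * recipPoly β (s.erase i) = 1 := by
  rw [Finset.sum_congr rfl fun i hi => C_pfCoeff_mul_recipPoly_erase hβ hi]
  exact Lagrange.sum_basis (fun i hi j hj h => hinj hi hj (inv_injective h)) hs

theorem sum_pfCoeff_smul_aeval_shift (hβ : ∀ i ∈ s, β i ≠ 0) (hinj : Set.InjOn β s)
    (hs : s.Nonempty) (y : ℕ → K) :
    ∑ i ∈ s, pfCoeff β s i • aeval (shift K) (recipPoly β (s.erase i)) y = y := by
  have h := congrArg (fun p => aeval (shift K) p y) (sum_C_pfCoeff_mul_recipPoly_erase hβ hinj hs)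
  simpa only [map_sum, ← smul_eq_C_mul, map_smul, LinearMap.sum_apply, LinearMap.smul_apply,
    map_one, Module.End.one_apply] using h

theorem pfKernel_zero (hβ : ∀ i ∈ s, β i ≠ 0) (hinj : Set.InjOn β s) (hs : s.Nonempty) :
    pfKernel β s 0 = 1 := by
  have h := congrArg (eval 0) (sum_C_pfCoeff_mul_recipPoly_erase hβ hinj hs)
  simpa only [pfKernel, pow_zero, eval_finsetSum, eval_mul, eval_C, eval_zero_recipPoly,
    eval_one, mul_one] using h

theorem pfKernel_insert {a : ι} (ha : a ∉ s) (hinj : Set.InjOn β (insert a s)) (k : ℕ) :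
    pfKernel β (insert a s) (k + 1) =
      pfKernel β s (k + 1) + β a * pfKernel β (insert a s) k := by
  rw [← sub_eq_iff_eq_add, pfKernel, pfKernel, pfKernel, Finset.mul_sum, ← Finset.sum_sub_distrib,
    Finset.sum_insert ha, pow_succ', mul_left_comm, sub_self, zero_add]
  refine Finset.sum_congr rfl fun i hi => ?_
  have hne : i ≠ a := ne_of_mem_of_not_mem hi ha
  have hsub : β i - β a ≠ 0 :=
    sub_ne_zero.2 fun h => hne (hinj (Set.mem_insert_of_mem a hi) (Set.mem_insert a _) h)
  have pfCoeff_insert : pfCoeff β (insert a s) i = β i / (β i - β a) * pfCoeff β s i := by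
    rw [pfCoeff, Finset.erase_insert_of_ne hne.symm, Finset.prod_insert, pfCoeff]
    exact fun h => ha (Finset.mem_of_mem_erase h)
  rw [pfCoeff_insert]
  field_simp
  ring

theorem pfKernel_pos_and_succ_le [LinearOrder K] [IsStrictOrderedRing K] (hs : s.Nonempty)
    (hβ : ∀ i ∈ s, 0 < β i) (hinj : Set.InjOn β s) :
    ∀ k, 0 < pfKernel β s k ∧ pfKernel β s (k + 1) ≤ (∑ i ∈ s, β i) * pfKernel β s k := by
  induction hs using Finset.Nonempty.cons_induction with
  | singleton a =>
    intro k
    simp only [pfKernel, pfCoeff, Finset.erase_singleton, Finset.prod_empty, Finset.sum_singleton,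
      one_mul]
    exact ⟨pow_pos (hβ a (Finset.mem_singleton_self a)) k, (pow_succ' _ _).le⟩
  | cons a s ha hs ih =>
    have hβs : ∀ i ∈ s, 0 < β i := fun i hi => hβ i (Finset.mem_cons_of_mem hi)
    have hinjs : Set.InjOn β s := hinj.mono fun i => Finset.mem_cons_of_mem
    have hβa : 0 < β a := hβ a (Finset.mem_cons_self a s)
    specialize ih hβs hinjs
    have head := pfKernel_zero (fun i hi => (hβ i hi).ne') hinj (Finset.cons_nonempty ha)
    rw [Finset.cons_eq_insert] at head hinj ⊢
    have recursion := pfKernel_insert ha (Finset.coe_insert a s ▸ hinj)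
    have pos : ∀ k, 0 < pfKernel β (insert a s) k := by
      intro k
      induction k with
      | zero => rw [head]; exact one_pos
      | succ k ihk =>
        rw [recursion]
        exact add_pos (ih (k + 1)).1 (mul_pos hβa ihk)
    have le_insert : ∀ k, pfKernel β s k ≤ pfKernel β (insert a s) k := by
      rintro (_ | k)
      · rw [head, pfKernel_zero (fun i hi => (hβs i hi).ne') hinjs hs]
      · rw [recursion]
        exact le_add_of_nonneg_right (mul_pos hβa (pos k)).le
    refine fun k => ⟨pos k, ?_⟩
    rw [recursion, Finset.sum_insert ha, add_mul, add_comm]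
    gcongr
    exact (ih k).2.trans
      (mul_le_mul_of_nonneg_left (le_insert k) (Finset.sum_nonneg fun i hi => (hβs i hi).le))

theorem isHalvingKernel_pfKernel {β : ι → ℝ} (hs : s.Nonempty) (hβ : ∀ i ∈ s, 0 < β i)
    (hinj : Set.InjOn β s) (hsum : ∑ i ∈ s, β i ≤ 1 / 2) : IsHalvingKernel (pfKernel β s) where
  zero := pfKernel_zero (fun i hi => (hβ i hi).ne') hinj hs
  pos k := (pfKernel_pos_and_succ_le hs hβ hinj k).1
  succ_le k := by
    obtain ⟨pos, succ_le⟩ := pfKernel_pos_and_succ_le hs hβ hinj k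
    nlinarith

end PartialFractions

theorem exists_eq_sum_pow_of_aeval_recipPoly_eq_zero {ι K : Type*} [Field K] {β : ι → K}
    {s : Finset ι} (hβ : ∀ i ∈ s, β i ≠ 0)
    (hinj : Set.InjOn β s) (hs : s.Nonempty) {y : ℕ → K}
    (hy : aeval (shift K) (recipPoly β s) y = 0) :
    ∃ g : ι → K, ∀ n, y n = ∑ i ∈ s, g i * (β i)⁻¹ ^ n := by
  classical
  have geometric : ∀ i ∈ s, ∀ n, aeval (shift K) (recipPoly β (s.erase i)) y n =
      aeval (shift K) (recipPoly β (s.erase i)) y 0 * (β i)⁻¹ ^ n := by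
    intro i hi n
    rw [recipPoly_eq_mul_erase hi, map_mul, Module.End.mul_apply] at hy
    induction n with
    | zero => rw [pow_zero, mul_one]
    | succ n ih =>
      have hn := congrFun hy n
      rw [aeval_shift_one_sub_C_mul_X, Pi.zero_apply, sub_eq_zero, ih] at hn
      rw [pow_succ, ← mul_assoc, hn, mul_comm (β i), mul_inv_cancel_right₀ (hβ i hi)]
  refine ⟨fun i => pfCoeff β s i * aeval (shift K) (recipPoly β (s.erase i)) y 0, fun n => ?_⟩
  conv_lhs => rw [← sum_pfCoeff_smul_aeval_shift hβ hinj hs y, Finset.sum_apply]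
  refine Finset.sum_congr rfl fun i hi => ?_
  rw [Pi.smul_apply, smul_eq_mul, geometric i hi n, mul_assoc]

section Inversion

variable {ι : Type*} {β : ι → ℝ} {s : Finset ι} {h y : ℕ → ℝ} {B : ℝ}

theorem summable_mul_of_abs_le (hh : Summable h) (hy : ∀ n, |y n| ≤ B) (n : ℕ) :
    Summable fun k => h k * y (n + k) := by
  refine (hh.abs.mul_right B).of_norm_bounded fun k => ?_
  rw [norm_mul, Real.norm_eq_abs, Real.norm_eq_abs]
  exact mul_le_mul_of_nonneg_left (hy _) (abs_nonneg _)

theorem corr_aeval_shift (hh : Summable h) (hy : ∀ n, |y n| ≤ B) (p : ℝ[X]) :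
    corr h (aeval (shift ℝ) p y) = aeval (shift ℝ) p (corr h y) := by
  funext n
  simp only [aeval_shift_apply, corr, Finset.mul_sum, ← tsum_mul_left]
  rw [Summable.tsum_finsetSum fun j _ => ?_]
  · refine Finset.sum_congr rfl fun j _ => tsum_congr fun k => ?_
    rw [mul_left_comm, add_right_comm]
  · simp only [mul_left_comm (h _), add_right_comm n _ j]
    exact (summable_mul_of_abs_le hh hy (n + j)).mul_left _

theorem aeval_one_sub_C_mul_X_corr_pow {b : ℝ} (hb : |b| < 1) (hy : ∀ n, |y n| ≤ B) :
    aeval (shift ℝ) (1 - C b * X) (corr (fun k => b ^ k) y) = y := by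
  funext n
  have hs := summable_mul_of_abs_le (summable_geometric_of_abs_lt_one hb) hy n
  rw [aeval_shift_one_sub_C_mul_X, corr, hs.tsum_eq_zero_add, corr, ← tsum_mul_left, pow_zero,
    one_mul, add_zero, sub_eq_iff_eq_add]
  congr 1
  exact tsum_congr fun k => by rw [pow_succ', mul_assoc, add_right_comm, add_assoc]

theorem abs_aeval_recipPoly_le (hy : ∀ n, |y n| ≤ B) (n : ℕ) :
    |aeval (shift ℝ) (recipPoly β s) y n| ≤ (∏ i ∈ s, (1 + |β i|)) * B := by
  classical
  induction s using Finset.induction_on generalizing n with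
  | empty => simpa [recipPoly] using hy n
  | insert a s ha ih =>
    rw [recipPoly, Finset.prod_insert ha, map_mul, Module.End.mul_apply,
      aeval_shift_one_sub_C_mul_X, Finset.prod_insert ha, mul_assoc, add_mul, one_mul]
    refine (abs_sub _ _).trans ?_
    rw [abs_mul]
    exact add_le_add (ih n) (mul_le_mul_of_nonneg_left (ih (n + 1)) (abs_nonneg _))

variable [DecidableEq ι]

theorem summable_pfKernel (hβ : ∀ i ∈ s, |β i| < 1) : Summable (pfKernel β s) :=
  summable_sum fun i hi => (summable_geometric_of_abs_lt_one (hβ i hi)).mul_left _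

theorem corr_pfKernel (hβ : ∀ i ∈ s, |β i| < 1) (hy : ∀ n, |y n| ≤ B) :
    corr (pfKernel β s) y = ∑ i ∈ s, pfCoeff β s i • corr (fun k => β i ^ k) y := by
  funext n
  rw [Finset.sum_apply, corr]
  simp only [Pi.smul_apply, smul_eq_mul, corr, pfKernel, ← tsum_mul_left, Finset.sum_mul,
    mul_assoc]
  exact Summable.tsum_finsetSum fun i hi =>
    (summable_mul_of_abs_le (summable_geometric_of_abs_lt_one (hβ i hi)) hy n).mul_left _

theorem aeval_recipPoly_corr_pfKernel (hβ₀ : ∀ i ∈ s, β i ≠ 0) (hβ₁ : ∀ i ∈ s, |β i| < 1)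
    (hinj : Set.InjOn β s) (hs : s.Nonempty) (hy : ∀ n, |y n| ≤ B) :
    aeval (shift ℝ) (recipPoly β s) (corr (pfKernel β s) y) = y := by
  conv_rhs => rw [← sum_pfCoeff_smul_aeval_shift hβ₀ hinj hs y]
  rw [corr_pfKernel hβ₁ hy, map_sum]
  refine Finset.sum_congr rfl fun i hi => ?_
  rw [map_smul, recipPoly_eq_mul_erase hi, mul_comm, map_mul, Module.End.mul_apply,
    aeval_one_sub_C_mul_X_corr_pow (hβ₁ i hi) hy]

theorem corr_pfKernel_aeval_recipPoly (hβ₀ : ∀ i ∈ s, β i ≠ 0) (hβ₁ : ∀ i ∈ s, |β i| < 1)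
    (hinj : Set.InjOn β s) (hs : s.Nonempty) (hy : ∀ n, |y n| ≤ B) :
    corr (pfKernel β s) (aeval (shift ℝ) (recipPoly β s) y) = y := by
  rw [corr_aeval_shift (summable_pfKernel hβ₁) hy,
    aeval_recipPoly_corr_pfKernel hβ₀ hβ₁ hinj hs hy]

end Inversion

/-! ### Generating functions -/

section GeneratingFunctions

variable {x : ℝ} {e : ℕ → Bool}

/-- The generating function of the signs `(-1) ^ e n`. -/
noncomputable def signSeries (e : ℕ → Bool) (x : ℝ) : ℝ := ∑' n, x ^ n * (-1) ^ (e n).toNat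

theorem summable_mul_neg_one_pow (hx : |x| < 1) (e : ℕ → ℕ) :
    Summable fun n => x ^ n * (-1) ^ e n := by
  refine (summable_geometric_of_abs_lt_one hx).abs.of_norm_bounded fun n => ?_
  rw [norm_mul, norm_pow, norm_pow, norm_neg, norm_one, one_pow, mul_one, Real.norm_eq_abs, abs_pow]

theorem signSeries_morse (hx : |x| < 1) (c : ℕ → Bool) :
    signSeries (morse c) x = (1 - x) * signSeries c (x ^ 2) := by
  have hs : Summable fun k => (x ^ 2) ^ k * (-1) ^ (c k).toNat :=
    summable_mul_neg_one_pow (by rw [abs_pow]; exact pow_lt_one₀ (abs_nonneg x) hx two_ne_zero) _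
  have even : ∀ k, x ^ (2 * k) * (-1) ^ (morse c (2 * k)).toNat =
      (x ^ 2) ^ k * (-1) ^ (c k).toNat := fun k => by rw [morse_two_mul, pow_mul]
  have odd : ∀ k, x ^ (2 * k + 1) * (-1) ^ (morse c (2 * k + 1)).toNat =
      -x * ((x ^ 2) ^ k * (-1) ^ (c k).toNat) := fun k => by
    rw [morse_two_mul_add_one, pow_succ, pow_mul]
    cases c k <;> simp [mul_comm]
  rw [signSeries, ← tsum_even_add_odd (hs.congr fun k => (even k).symm)
    ((hs.mul_left (-x)).congr fun k => (odd k).symm), tsum_congr even, tsum_congr odd,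
    tsum_mul_left, signSeries]
  ring

theorem signSeries_morse_iterate (hx : |x| < 1) (k : ℕ) (c : ℕ → Bool) :
    signSeries (morse^[k] c) x =
      (∏ m ∈ Finset.range k, (1 - x ^ 2 ^ m)) * signSeries c (x ^ 2 ^ k) := by
  induction k generalizing c with
  | zero => simp
  | succ k ih =>
    have hxk : |x ^ 2 ^ k| < 1 := by
      rw [abs_pow]
      exact pow_lt_one₀ (abs_nonneg x) hx (by positivity)
    rw [Function.iterate_succ_apply, ih, signSeries_morse hxk, Finset.prod_range_succ, ← pow_mul,
      ← pow_succ, mul_assoc]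

theorem signSeries_morsePeriodic_succ (hx₀ : 0 ≤ x) (hx₁ : x < 1) (k : ℕ) :
    signSeries (morsePeriodic (k + 1)) x =
      (∏ m ∈ Finset.range k, (1 - x ^ 2 ^ m)) / (1 + x ^ 2 ^ k) := by
  have hxk₀ : 0 ≤ x ^ 2 ^ k := pow_nonneg hx₀ _
  have hxk₁ : x ^ 2 ^ k < 1 := pow_lt_one₀ hx₀ hx₁ (by positivity)
  have signSeries_false :
      signSeries (fun _ => false) (x ^ 2 ^ (k + 1)) = (1 - (x ^ 2 ^ k) ^ 2)⁻¹ := by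
    rw [pow_succ 2 k, pow_mul, signSeries]
    simp only [Bool.toNat_false, pow_zero, mul_one]
    exact tsum_geometric_of_lt_one (pow_nonneg hxk₀ 2) (pow_lt_one₀ hxk₀ hxk₁ two_ne_zero)
  rw [morsePeriodic, signSeries_morse_iterate (by rwa [abs_of_nonneg hx₀]),
    Finset.prod_range_succ, signSeries_false]
  have one_sub_ne : 1 - x ^ 2 ^ k ≠ 0 := by linarith
  have one_add_ne : 1 + x ^ 2 ^ k ≠ 0 := by linarith
  rw [show 1 - (x ^ 2 ^ k) ^ 2 = (1 - x ^ 2 ^ k) * (1 + x ^ 2 ^ k) by ring]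
  field_simp

theorem wsum_decrement_pow (hx₀ : 0 < x) (hx₁ : x < 1) (he : e 0 = false) :
    wsum (decrement fun k => x ^ k) e = (1 - (1 - x) * signSeries e x) / (2 * x) := by
  have hx : |x| < 1 := by rwa [abs_of_pos hx₀]
  have signs := summable_mul_neg_one_pow hx fun n => (e n).toNat
  have shifted := summable_mul_neg_one_pow hx fun n => (e (n + 1)).toNat
  have digit : ∀ a : Bool, (a.toNat : ℝ) = (1 - (-1) ^ a.toNat) / 2 := by
    rintro (_ | _) <;> norm_num
  have signSeries_eq : signSeries e x = 1 + x * ∑' n, x ^ n * (-1) ^ (e (n + 1)).toNat := by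
    rw [signSeries, signs.tsum_eq_zero_add, ← tsum_mul_left, he]
    simp only [pow_zero, Bool.toNat_false, mul_one, pow_succ', mul_assoc]
  have wsum_eq : wsum (decrement fun k => x ^ k) e =
      (1 - x) / 2 * ((1 - x)⁻¹ - ∑' n, x ^ n * (-1) ^ (e (n + 1)).toNat) := by
    rw [wsum, ← tsum_geometric_of_lt_one hx₀.le hx₁,
      ← (summable_geometric_of_lt_one hx₀.le hx₁).tsum_sub shifted, ← tsum_mul_left]
    exact tsum_congr fun n => by rw [decrement, digit]; ring
  have one_sub_ne : 1 - x ≠ 0 := sub_ne_zero.2 hx₁.ne'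
  rw [wsum_eq, signSeries_eq]
  field_simp
  ring

theorem Efin_eq_wsum (hx₀ : 0 < x) (hx₁ : x < 1) (k : ℕ) :
    Efin k x = wsum (decrement fun k => x ^ k) (morsePeriodic (k + 1)) := by
  rw [wsum_decrement_pow hx₀ hx₁ (morsePeriodic_apply_zero _),
    signSeries_morsePeriodic_succ hx₀.le hx₁, Efin]
  field_simp

theorem summable_pow_two_pow (hx₀ : 0 ≤ x) (hx₁ : x < 1) : Summable fun m : ℕ => x ^ 2 ^ m :=
  (summable_geometric_of_lt_one hx₀ hx₁).of_nonneg_of_le (fun _ => pow_nonneg hx₀ _)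
    fun _ => pow_le_pow_of_le_one hx₀ hx₁.le Nat.lt_two_pow_self.le

theorem tendsto_Efin (hx₀ : 0 < x) (hx₁ : x < 1) :
    Tendsto (fun k => Efin k x) atTop (𝓝 (E x)) := by
  have hs := summable_pow_two_pow hx₀.le hx₁
  have multipliable : Multipliable fun m : ℕ => 1 - x ^ 2 ^ m := by
    simpa only [sub_eq_add_neg] using Real.multipliable_one_add_of_summable hs.neg
  have denominator := hs.tendsto_atTop_zero.const_add 1
  have numerator := denominator.sub (multipliable.tendsto_prod_tprod_nat.const_mul (1 - x))
  simpa only [Efin, E, add_zero, mul_one, Pi.div_def] using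
    numerator.div (denominator.const_mul (2 * x)) (by simp [hx₀.ne'])

end GeneratingFunctions

section Multivariate

variable {ι : Type*} [DecidableEq ι] {s : Finset ι}

theorem summable_decrement_mul_toNat {h : ℕ → ℝ} (hh : Summable h) (e : ℕ → Bool) :
    Summable fun k => decrement h k * (e (k + 1)).toNat := by
  refine (hh.sub ((summable_nat_add_iff 1).2 hh)).abs.of_norm_bounded fun k => ?_
  rw [norm_mul, Real.norm_natCast, Real.norm_eq_abs]
  exact mul_toNat_le (abs_nonneg _) _

theorem wsum_decrement_pfKernel {β : ι → ℝ} (hβ : ∀ i ∈ s, |β i| < 1) (e : ℕ → Bool) :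
    wsum (decrement (pfKernel β s)) e =
      ∑ i ∈ s, pfCoeff β s i * wsum (decrement fun k => β i ^ k) e := by
  simp only [wsum, ← tsum_mul_left]
  rw [← Summable.tsum_finsetSum fun i hi => (summable_decrement_mul_toNat
    (summable_geometric_of_abs_lt_one (hβ i hi)) e).mul_left (pfCoeff β s i)]
  refine tsum_congr fun k => ?_
  rw [decrement, pfKernel, pfKernel, ← Finset.sum_sub_distrib, Finset.sum_mul]
  exact Finset.sum_congr rfl fun i _ => by rw [decrement]; ring

variable {r : ℕ} {β : Fin r → ℝ}

theorem EmultiFin_eq_wsum (hβ₀ : ∀ i, 0 < β i) (hβ₁ : ∀ i, β i < 1) (k : ℕ) :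
    EmultiFin k β = wsum (decrement (pfKernel β Finset.univ)) (morsePeriodic (k + 1)) := by
  rw [wsum_decrement_pfKernel fun i _ => by rw [abs_of_pos (hβ₀ i)]; exact hβ₁ i, EmultiFin]
  exact Finset.sum_congr rfl fun i _ => by rw [Efin_eq_wsum (hβ₀ i) (hβ₁ i), pfCoeff]

theorem tendsto_EmultiFin (hβ₀ : ∀ i, 0 < β i) (hβ₁ : ∀ i, β i < 1) :
    Tendsto (fun k => EmultiFin k β) atTop (𝓝 (Emulti β)) :=
  tendsto_finsetSum _ fun i _ => (tendsto_Efin (hβ₀ i) (hβ₁ i)).const_mul _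

theorem Emulti_eq_wsum (hβ₀ : ∀ i, 0 < β i) (hβ₁ : ∀ i, β i < 1)
    (hK : IsWeight (decrement (pfKernel β Finset.univ))) :
    Emulti β = wsum (decrement (pfKernel β Finset.univ)) thueMorse := by
  refine tendsto_nhds_unique (tendsto_EmultiFin hβ₀ hβ₁) ?_
  simp only [EmultiFin_eq_wsum hβ₀ hβ₁]
  exact hK.tendsto_wsum_morsePeriodic.comp (tendsto_add_atTop_nat 1)

end Multivariate

/-! ### From solutions to integer sources and back -/

section IntegerRecurrences

variable {R S : Type*} [CommRing R] [CommRing S]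

theorem aeval_shift_map (f : R →+* S) (p : R[X]) (y : ℕ → R) :
    aeval (shift S) (p.map f) (fun n => f (y n)) = fun n => f (aeval (shift R) p y n) := by
  funext n
  rw [aeval_eq_sum_range' (natDegree_map_le.trans_lt p.natDegree.lt_succ_self), aeval_shift_apply,
    LinearMap.sum_apply, Finset.sum_apply, map_sum]
  exact Finset.sum_congr rfl fun j _ => by
    rw [LinearMap.smul_apply, Pi.smul_apply, shift_pow_apply, smul_eq_mul, coeff_map, map_mul]

theorem aeval_shift_comp_add (p : R[X]) (y : ℕ → R) (N : ℕ) :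
    aeval (shift R) p (fun n => y (n + N)) = fun n => aeval (shift R) p y (n + N) := by
  funext n
  simp only [aeval_shift_apply, add_right_comm n _ N]

/-- A solution of the linear recurrence with monic characteristic polynomial `p` and right-hand
side `t`, started with zeros. -/
def solveRecurrence (p : R[X]) (t : ℕ → R) (n : ℕ) : R :=
  if _ : n < p.natDegree then 0
  else t (n - p.natDegree) -
    ∑ j : Fin p.natDegree, p.coeff j * solveRecurrence p t (n - p.natDegree + j)
termination_by n
decreasing_by omega

theorem aeval_shift_surjective {p : R[X]} (hp : p.Monic) :
    Function.Surjective (aeval (shift R) p) := by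
  refine fun t => ⟨solveRecurrence p t, funext fun n => ?_⟩
  rw [aeval_shift_apply, Finset.sum_range_succ, hp.coeff_natDegree, one_mul,
    solveRecurrence.eq_1 p t (n + p.natDegree), dif_neg (by omega), Nat.add_sub_cancel,
    Finset.sum_range fun j => p.coeff j * solveRecurrence p t (n + j), add_sub_cancel]

end IntegerRecurrences

section DistanceToIntegers

variable {a x : ℝ}

theorem distInt_nonneg (x : ℝ) : 0 ≤ distInt x := abs_nonneg _

theorem distInt_le_half (x : ℝ) : distInt x ≤ 1 / 2 := abs_sub_round x

theorem distInt_intCast_add (m : ℤ) (hx : |x| ≤ 1 / 2) : distInt (m + x) = |x| := by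
  rw [distInt, round_intCast_add, Int.cast_add, add_sub_add_left_eq_sub]
  refine le_antisymm (by simpa using round_le x 0) ?_
  obtain h | h := eq_or_ne (round x) 0
  · simp [h]
  · have one_le : (1 : ℝ) ≤ |(round x : ℝ)| := by exact_mod_cast Int.one_le_abs h
    have triangle := abs_sub_abs_le_abs_sub (round x : ℝ) x
    rw [abs_sub_comm] at triangle
    linarith

theorem limsup_const_mul_distInt (ha : 0 ≤ a) (y : ℕ → ℝ) :
    limsup (fun n => a * distInt (y n)) atTop = a * limsup (fun n => distInt (y n)) atTop :=
  ((monotone_mul_left_of_nonneg ha).map_limsup_of_continuousAt _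
    (continuous_const_mul a).continuousAt
    (isBoundedUnder_of ⟨1 / 2, fun n => distInt_le_half (y n)⟩)
    (isBoundedUnder_of ⟨0, fun n => distInt_nonneg (y n)⟩).isCoboundedUnder_le).symm

end DistanceToIntegers

section IntegerSources

variable {ι : Type*} {β : ι → ℝ} {s : Finset ι} {P : ℤ[X]} {a : ℝ} {y w : ℕ → ℝ}

theorem abs_lt_one_of_sum_le_half (hβ : ∀ i ∈ s, 0 < β i) (hsum : ∑ i ∈ s, β i ≤ 1 / 2) :
    ∀ i ∈ s, |β i| < 1 := fun i hi => by
  rw [abs_of_pos (hβ i hi)]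
  linarith [Finset.single_le_sum (fun j hj => (hβ j hj).le) hi]

theorem prod_one_add_abs_le_two (hsum : ∑ i ∈ s, |β i| ≤ 1 / 2) : ∏ i ∈ s, (1 + |β i|) ≤ 2 :=
  calc ∏ i ∈ s, (1 + |β i|) ≤ Real.exp (∑ i ∈ s, |β i|) :=
        Real.prod_one_add_le_exp_sum _ fun _ => abs_nonneg _
    _ ≤ Real.exp (1 / 2) := Real.exp_le_exp.2 hsum
    _ ≤ 1 / (1 - 1 / 2) := Real.exp_bound_div_one_sub_of_interval (by norm_num) (by norm_num)
    _ = 2 := by norm_num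

theorem exists_int_eq_aeval_recipPoly (hPβ : P.map (Int.castRingHom ℝ) = C a * recipPoly β s)
    (hy : aeval (shift ℝ) (P.map (Int.castRingHom ℝ)) y = 0) :
    ∃ t : ℕ → ℤ, aeval (shift ℝ) (recipPoly β s) (fun n => a * (y n - round (y n))) =
      fun n => (t n : ℝ) := by
  refine ⟨-aeval (shift ℤ) P fun n => round (y n), ?_⟩
  have scale : (fun n => a * (y n - round (y n))) = a • (y - fun n => (round (y n) : ℝ)) := rfl
  have rounded := aeval_shift_map (Int.castRingHom ℝ) P fun n => round (y n)
  simp only [eq_intCast] at rounded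
  rw [scale, map_smul, ← LinearMap.smul_apply, ← map_smul, smul_eq_C_mul, ← hPβ, map_sub, hy,
    rounded]
  funext n
  simp

theorem exists_int_aeval_shift_add_eq_zero (hP : P.Monic) (ha : a ≠ 0)
    (hPβ : P.map (Int.castRingHom ℝ) = C a * recipPoly β s) {t : ℕ → ℤ}
    (hw : aeval (shift ℝ) (recipPoly β s) w = fun n => (t n : ℝ)) :
    ∃ u : ℕ → ℤ,
      aeval (shift ℝ) (P.map (Int.castRingHom ℝ)) (fun n => u n + a⁻¹ * w n) = 0 := by
  obtain ⟨u, hu⟩ := aeval_shift_surjective hP (-t)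
  refine ⟨u, ?_⟩
  have split : (fun n => (u n : ℝ) + a⁻¹ * w n) = (fun n => (u n : ℝ)) + a⁻¹ • w := rfl
  have integral := aeval_shift_map (Int.castRingHom ℝ) P u
  simp only [eq_intCast] at integral
  rw [split, map_add, integral, hu, map_smul, hPβ, map_mul, Module.End.mul_apply, hw, aeval_C,
    Module.algebraMap_end_apply, inv_smul_smul₀ ha]
  funext n
  simp

theorem abs_mul_distInt (a x : ℝ) : |a| * distInt x = |a * (x - round x)| :=
  (abs_mul _ _).symm

variable [DecidableEq ι]

theorem exists_limsup_distInt_eq_of_le (ha : a ≠ 0)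
    (hPβ : P.map (Int.castRingHom ℝ) = C a * recipPoly β s) (hs : s.Nonempty)
    (hβ : ∀ i ∈ s, 0 < β i) (hinj : Set.InjOn β s) (hsum : ∑ i ∈ s, β i ≤ 1 / 2)
    (hy : aeval (shift ℝ) (P.map (Int.castRingHom ℝ)) y = 0) {M : ℝ}
    (hM : M < |a|⁻¹ * wsum (decrement (pfKernel β s)) thueMorse) (hyM : ∀ n, distInt (y n) ≤ M) :
    ∃ k, limsup (fun n => distInt (y n)) atTop =
      |a|⁻¹ * wsum (decrement (pfKernel β s)) (morsePeriodic k) := by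
  have kernel := isHalvingKernel_pfKernel hs hβ hinj hsum
  have abs_a : 0 < |a| := abs_pos.2 ha
  rw [inv_mul_eq_div, lt_div_iff₀' abs_a] at hM
  have error_le : ∀ n, |a * (y n - round (y n))| ≤ |a| * M := fun n => by
    rw [← abs_mul_distInt]
    exact mul_le_mul_of_nonneg_left (hyM n) abs_a.le
  obtain ⟨t, ht⟩ := exists_int_eq_aeval_recipPoly hPβ hy
  have corr_eq : corr (pfKernel β s) (fun n => (t n : ℝ)) =
      fun n => a * (y n - round (y n)) := by
    rw [← ht]
    exact corr_pfKernel_aeval_recipPoly (fun i hi => (hβ i hi).ne')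
      (abs_lt_one_of_sum_le_half hβ hsum) hinj hs error_le
  have abs_t_le : ∀ n, |t n| ≤ 1 := fun n => by
    have prod_le : ∏ i ∈ s, (1 + |β i|) ≤ 2 := prod_one_add_abs_le_two <| by
      rwa [Finset.sum_congr rfl fun i hi => abs_of_pos (hβ i hi)]
    have error_lt : |a| * M < 1 := hM.trans_le (kernel.wsum_decrement_le_one _)
    have source_le := abs_aeval_recipPoly_le (β := β) (s := s) error_le n
    rw [ht] at source_le
    have error_nonneg : 0 ≤ |a| * M := (abs_nonneg _).trans (error_le n)
    have source_lt : |(t n : ℝ)| < 2 := by nlinarith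
    exact Int.lt_add_one_iff.1 (by exact_mod_cast source_lt)
  obtain ⟨k, hk⟩ := kernel.exists_limsup_abs_corr_eq hM abs_t_le fun n => by
    rw [corr_eq]
    exact error_le n
  refine ⟨k, ?_⟩
  simp only [corr_eq, ← abs_mul_distInt] at hk
  rw [← hk, limsup_const_mul_distInt abs_a.le, inv_mul_cancel_left₀ abs_a.ne']

theorem exists_limsup_distInt_eq (ha : a ≠ 0)
    (hPβ : P.map (Int.castRingHom ℝ) = C a * recipPoly β s) (hs : s.Nonempty)
    (hβ : ∀ i ∈ s, 0 < β i) (hinj : Set.InjOn β s) (hsum : ∑ i ∈ s, β i ≤ 1 / 2)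
    (hy : aeval (shift ℝ) (P.map (Int.castRingHom ℝ)) y = 0)
    (hlt : limsup (fun n => distInt (y n)) atTop <
      |a|⁻¹ * wsum (decrement (pfKernel β s)) thueMorse) :
    ∃ k, limsup (fun n => distInt (y n)) atTop =
      |a|⁻¹ * wsum (decrement (pfKernel β s)) (morsePeriodic k) := by
  obtain ⟨M, hltM, hM⟩ := exists_between hlt
  obtain ⟨N, hN⟩ := eventually_atTop.1 (eventually_lt_of_limsup_lt hltM
    (isBoundedUnder_of ⟨1 / 2, fun n => distInt_le_half (y n)⟩))
  have shifted : aeval (shift ℝ) (P.map (Int.castRingHom ℝ)) (fun n => y (n + N)) = 0 := by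
    rw [aeval_shift_comp_add, hy]
    rfl
  rw [← limsup_nat_add _ N]
  exact exists_limsup_distInt_eq_of_le ha hPβ hs hβ hinj hsum shifted hM fun n =>
    (hN (n + N) (Nat.le_add_left N n)).le

theorem exists_limsup_distInt_eq_wsum_morsePeriodic (hP : P.Monic) (ha : 2 ≤ |a|)
    (hPβ : P.map (Int.castRingHom ℝ) = C a * recipPoly β s) (hs : s.Nonempty)
    (hβ : ∀ i ∈ s, 0 < β i) (hinj : Set.InjOn β s) (hsum : ∑ i ∈ s, β i ≤ 1 / 2) (k : ℕ) :
    ∃ y, aeval (shift ℝ) (P.map (Int.castRingHom ℝ)) y = 0 ∧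
      limsup (fun n => distInt (y n)) atTop =
        |a|⁻¹ * wsum (decrement (pfKernel β s)) (morsePeriodic k) := by
  have kernel := isHalvingKernel_pfKernel hs hβ hinj hsum
  have abs_a : 0 < |a| := two_pos.trans_le ha
  set w := corr (pfKernel β s) fun n => (digitDiff (morsePeriodic k) n : ℝ) with hw
  have source_le : ∀ n, |(digitDiff (morsePeriodic k) n : ℝ)| ≤ 1 := fun n => by
    rw [digitDiff]
    cases morsePeriodic k n <;> cases morsePeriodic k (n + 1) <;> norm_num
  obtain ⟨u, hu⟩ := exists_int_aeval_shift_add_eq_zero hP (abs_pos.1 abs_a) hPβ <|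
    aeval_recipPoly_corr_pfKernel (fun i hi => (hβ i hi).ne')
      (abs_lt_one_of_sum_le_half hβ hsum) hinj hs source_le
  have distInt_eq : ∀ n, |a| * distInt (u n + a⁻¹ * w n) = |w n| := fun n => by
    have w_le : |w n| ≤ 1 := kernel.abs_corr_digitDiff_le_one _ n
    have abs_eq : |a⁻¹ * w n| = |w n| / |a| := by rw [abs_mul, abs_inv, inv_mul_eq_div]
    rw [distInt_intCast_add, abs_eq, mul_div_cancel₀ _ abs_a.ne']
    rw [abs_eq, div_le_iff₀ abs_a]
    linarith
  refine ⟨_, hu, ?_⟩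
  rw [← kernel.limsup_abs_corr_morsePeriodic, ← hw]
  simp only [← distInt_eq]
  rw [limsup_const_mul_distInt abs_a.le, inv_mul_cancel_left₀ abs_a.ne']

end IntegerSources

/-! ### The spectrum -/

section Spectrum

variable {ι : Type*} [Fintype ι] {P : ℤ[X]} {α : ι → ℝ}

theorem map_intCast_eq_prod (hP : P.Monic)
    (hroots : P.aroots ℂ = Finset.univ.val.map fun i => (α i : ℂ)) :
    P.map (Int.castRingHom ℝ) = ∏ i, (X - C (α i)) := by
  apply Polynomial.map_injective Complex.ofRealHom Complex.ofRealHom.injective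
  have cast_comp : Complex.ofRealHom.comp (Int.castRingHom ℝ) = algebraMap ℤ ℂ :=
    RingHom.ext_int _ _
  rw [Polynomial.map_map, Polynomial.map_prod, cast_comp,
    (IsAlgClosed.splits (P.map (algebraMap ℤ ℂ))).eq_prod_roots_of_monic (hP.map _),
    ← aroots_def, hroots, Multiset.map_map, Finset.prod_eq_multiset_prod]
  simp

theorem coeff_zero_eq_prod (hP : P.Monic)
    (hroots : P.aroots ℂ = Finset.univ.val.map fun i => (α i : ℂ)) :
    (P.coeff 0 : ℝ) = ∏ i, -α i := by
  rw [← eq_intCast (Int.castRingHom ℝ), ← coeff_map, map_intCast_eq_prod hP hroots,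
    coeff_zero_eq_eval_zero, eval_prod]
  simp

theorem map_intCast_eq_C_mul_recipPoly (hP : P.Monic)
    (hroots : P.aroots ℂ = Finset.univ.val.map fun i => (α i : ℂ)) (hα : ∀ i, α i ≠ 0) :
    P.map (Int.castRingHom ℝ) =
      C (P.coeff 0 : ℝ) * recipPoly (fun i => (α i)⁻¹) Finset.univ := by
  rw [map_intCast_eq_prod hP hroots, coeff_zero_eq_prod hP hroots, map_prod, recipPoly,
    ← Finset.prod_mul_distrib]
  refine Finset.prod_congr rfl fun i _ => ?_
  have cancel : C (α i) * C (α i)⁻¹ = 1 := by rw [← C_mul, mul_inv_cancel₀ (hα i), C_1]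
  rw [C_neg]
  linear_combination -X * cancel

theorem two_le_abs_coeff_zero [Nonempty ι] (hP : P.Monic)
    (hroots : P.aroots ℂ = Finset.univ.val.map fun i => (α i : ℂ)) (hα : ∀ i, 1 < α i)
    (hsum : ∑ i, (α i)⁻¹ ≤ 1 / 2) : 2 ≤ |(P.coeff 0 : ℝ)| := by
  classical
  obtain ⟨i⟩ := ‹Nonempty ι›
  have hpos : ∀ j, 0 < α j := fun j => one_pos.trans (hα j)
  have inv_le : (α i)⁻¹ ≤ 2⁻¹ := by
    rw [← one_div 2]
    exact (Finset.single_le_sum (f := fun j => (α j)⁻¹) (fun j _ => (inv_pos.2 (hpos j)).le)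
      (Finset.mem_univ i)).trans hsum
  calc (2 : ℝ) ≤ α i := (inv_le_inv₀ (hpos i) two_pos).1 inv_le
    _ ≤ α i * ∏ j ∈ Finset.univ.erase i, α j :=
      le_mul_of_one_le_right (hpos i).le (Finset.one_le_prod fun j _ => (hα j).le)
    _ = |(P.coeff 0 : ℝ)| := by
      rw [Finset.mul_prod_erase _ _ (Finset.mem_univ i), coeff_zero_eq_prod hP hroots,
        Finset.abs_prod]
      exact Finset.prod_congr rfl fun j _ => by rw [abs_neg, abs_of_pos (hpos j)]

theorem mem_expandingRoots_iff (hroots : P.aroots ℂ = Finset.univ.val.map fun i => (α i : ℂ))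
    (hα : ∀ i, 1 < α i) {z : ℂ} : z ∈ expandingRoots P ↔ ∃ i, (α i : ℂ) = z := by
  simp only [expandingRoots, hroots, Finset.mem_filter, Multiset.mem_toFinset, Multiset.mem_map,
    Finset.mem_val, Finset.mem_univ, true_and, and_iff_left_iff_imp]
  rintro ⟨i, rfl⟩
  rw [Complex.norm_real, Real.norm_eq_abs]
  exact (hα i).trans_le (le_abs_self _)

theorem recurrence_eq_sum (hroots : P.aroots ℂ = Finset.univ.val.map fun i => (α i : ℂ))
    (hinj : Function.Injective α) (hα : ∀ i, 1 < α i) {g : ℂ → ℂ[X]}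
    (hg : g ∈ coeffFamilies 0 P) (n : ℕ) :
    recurrence P g n = ∑ i, ((g (α i)).coeff 0).re * α i ^ n := by
  classical
  have expandingRoots_eq : expandingRoots P = Finset.univ.image fun i => (α i : ℂ) := by
    ext z
    simp [mem_expandingRoots_iff hroots hα]
  have hinj' : Function.Injective fun i => (α i : ℂ) := Complex.ofReal_injective.comp hinj
  rw [recurrence, expandingRoots_eq, Finset.sum_image hinj'.injOn, Complex.re_sum]
  refine Finset.sum_congr rfl fun i _ => ?_
  rw [eq_C_of_natDegree_le_zero (hg _ ((mem_expandingRoots_iff hroots hα).2 ⟨i, rfl⟩)).1, eval_C,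
    coeff_C_zero, zpow_natCast, ← Complex.ofReal_pow, Complex.re_mul_ofReal]

theorem exists_mem_coeffFamilies_zero
    (hroots : P.aroots ℂ = Finset.univ.val.map fun i => (α i : ℂ))
    (hinj : Function.Injective α) (hα : ∀ i, 1 < α i) (r : ι → ℝ) :
    ∃ g ∈ coeffFamilies 0 P, ∀ i, ((g (α i)).coeff 0).re = r i := by
  set G : ℂ → ℂ := Function.extend (fun i => (α i : ℂ)) (fun i => (r i : ℂ)) 0
  have G_apply : ∀ i, G (α i) = r i := (Complex.ofReal_injective.comp hinj).extend_apply _ _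
  refine ⟨fun z => C (G z), fun z hz => ⟨(natDegree_C _).le, ?_⟩, fun i => ?_⟩
  · obtain ⟨i, rfl⟩ := (mem_expandingRoots_iff hroots hα).1 hz
    simp only [Complex.conj_ofReal, G_apply, map_C]
  · rw [coeff_C_zero, G_apply, Complex.ofReal_re]

theorem mem_spectrum_iff [Nonempty ι] (hP : P.Monic)
    (hroots : P.aroots ℂ = Finset.univ.val.map fun i => (α i : ℂ))
    (hinj : Function.Injective α) (hα : ∀ i, 1 < α i) {v : ℝ} :
    v ∈ spectrum P ↔ ∃ y : ℕ → ℝ, aeval (shift ℝ) (P.map (Int.castRingHom ℝ)) y = 0 ∧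
      limsup (fun n => distInt (y n)) atTop = v := by
  classical
  have hne : ∀ i, α i ≠ 0 := fun i => (one_pos.trans (hα i)).ne'
  have coeff_ne : (P.coeff 0 : ℝ) ≠ 0 := by
    rw [coeff_zero_eq_prod hP hroots]
    exact Finset.prod_ne_zero_iff.2 fun i _ => neg_ne_zero.2 (hne i)
  have aeval_eq : ∀ y : ℕ → ℝ, aeval (shift ℝ) (P.map (Int.castRingHom ℝ)) y =
      (P.coeff 0 : ℝ) • aeval (shift ℝ) (recipPoly (fun i => (α i)⁻¹) Finset.univ) y := fun y => by
    rw [map_intCast_eq_C_mul_recipPoly hP hroots hne, ← smul_eq_C_mul, map_smul,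
      LinearMap.smul_apply]
  simp only [aeval_eq, smul_eq_zero_iff_right coeff_ne]
  constructor
  · rintro ⟨g, hg, rfl⟩
    refine ⟨_, aeval_recipPoly_sum_pow (fun i _ => inv_ne_zero (hne i))
      fun i => ((g (α i)).coeff 0).re, ?_⟩
    simp only [recurrence_eq_sum hroots hinj hα hg, inv_inv]
  · rintro ⟨y, hy, rfl⟩
    obtain ⟨r, hr⟩ := exists_eq_sum_pow_of_aeval_recipPoly_eq_zero
      (fun i _ => inv_ne_zero (hne i)) (inv_injective.comp hinj).injOn Finset.univ_nonempty hy
    obtain ⟨g, hg, hgr⟩ := exists_mem_coeffFamilies_zero hroots hinj hα r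
    refine ⟨g, hg, ?_⟩
    simp only [recurrence_eq_sum hroots hinj hα hg, hgr, hr, inv_inv]

variable [DecidableEq ι] [Nonempty ι]

theorem exists_eq_wsum_morsePeriodic_of_mem_spectrum (hP : P.Monic)
    (hroots : P.aroots ℂ = Finset.univ.val.map fun i => (α i : ℂ))
    (hinj : Function.Injective α) (hα : ∀ i, 1 < α i) (hsum : ∑ i, (α i)⁻¹ ≤ 1 / 2) {v : ℝ}
    (hv : v ∈ spectrum P) (hlt : v < |(P.coeff 0 : ℝ)|⁻¹ *
      wsum (decrement (pfKernel (fun i => (α i)⁻¹) Finset.univ)) thueMorse) :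
    ∃ k, v = |(P.coeff 0 : ℝ)|⁻¹ *
      wsum (decrement (pfKernel (fun i => (α i)⁻¹) Finset.univ)) (morsePeriodic k) := by
  have hpos : ∀ i, 0 < α i := fun i => one_pos.trans (hα i)
  have abs_coeff : 0 < |(P.coeff 0 : ℝ)| :=
    two_pos.trans_le (two_le_abs_coeff_zero hP hroots hα hsum)
  obtain ⟨y, hy, rfl⟩ := (mem_spectrum_iff hP hroots hinj hα).1 hv
  exact exists_limsup_distInt_eq (abs_pos.1 abs_coeff)
    (map_intCast_eq_C_mul_recipPoly hP hroots fun i => (hpos i).ne') Finset.univ_nonempty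
    (fun i _ => inv_pos.2 (hpos i)) (inv_injective.comp hinj).injOn hsum hy hlt

theorem wsum_morsePeriodic_mem_spectrum (hP : P.Monic)
    (hroots : P.aroots ℂ = Finset.univ.val.map fun i => (α i : ℂ))
    (hinj : Function.Injective α) (hα : ∀ i, 1 < α i) (hsum : ∑ i, (α i)⁻¹ ≤ 1 / 2) (k : ℕ) :
    |(P.coeff 0 : ℝ)|⁻¹ *
      wsum (decrement (pfKernel (fun i => (α i)⁻¹) Finset.univ)) (morsePeriodic k) ∈
        spectrum P := by
  have hpos : ∀ i, 0 < α i := fun i => one_pos.trans (hα i)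
  exact (mem_spectrum_iff hP hroots hinj hα).2 <| exists_limsup_distInt_eq_wsum_morsePeriodic hP
    (two_le_abs_coeff_zero hP hroots hα hsum)
    (map_intCast_eq_C_mul_recipPoly hP hroots fun i => (hpos i).ne') Finset.univ_nonempty
    (fun i _ => inv_pos.2 (hpos i)) (inv_injective.comp hinj).injOn hsum k

end Spectrum

theorem isLeast_setOf_accPt {X : Type*} [TopologicalSpace X] [LinearOrder X] [OrderTopology X]
    [DenselyOrdered X] {S : Set X} {e : X} {w : ℕ → X}
    (hw : Tendsto w atTop (𝓝 e)) (hmem : ∀ k, w k ∈ S) (hne : ∀ k, w k ≠ e)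
    (hS : ∀ v ∈ S, v < e → ∃ k, v = w k) : IsLeast {x | AccPt x (𝓟 S)} e := by
  constructor
  · exact accPt_iff_frequently.2 (hw.frequently (Frequently.of_forall fun k => ⟨hne k, hmem k⟩))
  · intro x hx
    by_contra hlt
    obtain ⟨c, hxc, hce⟩ := exists_between (not_le.1 hlt)
    obtain ⟨m, hm⟩ := eventually_atTop.1 (hw.eventually (lt_mem_nhds hce))
    have finite : (w '' Set.Iio m \ {x}).Finite := ((Set.finite_Iio m).image w).sdiff
    have eventually_notMem : ∀ᶠ y in 𝓝 x, y ∉ w '' Set.Iio m \ {x} :=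
      finite.isClosed.isOpen_compl.mem_nhds fun h => h.2 rfl
    obtain ⟨y, ⟨hyx, hyS⟩, hy, hyc⟩ := ((accPt_iff_frequently.1 hx).and_eventually
      (eventually_notMem.and (gt_mem_nhds hxc))).exists
    obtain ⟨k, rfl⟩ := hS y hyS (hyc.trans hce)
    exact hy ⟨⟨k, not_le.1 fun hk => lt_asymm hyc (hm k hk), rfl⟩, hyx⟩

end MarkoffLagrange

theorem corollary4p5 (P : ℤ[X]) (hP : P.Monic) (d : ℕ) (hd : 1 ≤ d) (α : Fin d → ℝ)
    (hroots : P.aroots ℂ = Finset.univ.val.map (fun i : Fin d => (α i : ℂ)))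
    (hsimple : Function.Injective α)
    (hα : ∀ i, 1 < α i)
    (hsum : ∑ i, (α i)⁻¹ ≤ 1 / 2) :
    IsLeast {x : ℝ | AccPt x (𝓟 (MarkoffLagrange.spectrum P))}
      (|(P.coeff 0 : ℝ)|⁻¹ * MarkoffLagrange.Emulti (fun i => (α i)⁻¹)) ∧
    MarkoffLagrange.spectrum P ∩
        Set.Ioo 0 (|(P.coeff 0 : ℝ)|⁻¹ * MarkoffLagrange.Emulti (fun i => (α i)⁻¹)) =
      {x : ℝ | ∃ k : ℕ,
        x = |(P.coeff 0 : ℝ)|⁻¹ * MarkoffLagrange.EmultiFin k (fun i => (α i)⁻¹)} := by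
  have : Nonempty (Fin d) := Fin.pos_iff_nonempty.1 hd
  have hβ₀ : ∀ i, 0 < (α i)⁻¹ := fun i => inv_pos.2 (one_pos.trans (hα i))
  have hβ₁ : ∀ i, (α i)⁻¹ < 1 := fun i => inv_lt_one_of_one_lt₀ (hα i)
  have weight := (MarkoffLagrange.isHalvingKernel_pfKernel Finset.univ_nonempty
    (fun i _ => hβ₀ i) (inv_injective.comp hsimple).injOn hsum).isWeight_decrement
  have scale : 0 < |(P.coeff 0 : ℝ)|⁻¹ :=
    inv_pos.2 (two_pos.trans_le (MarkoffLagrange.two_le_abs_coeff_zero hP hroots hα hsum))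
  have mem := MarkoffLagrange.wsum_morsePeriodic_mem_spectrum hP hroots hsimple hα hsum
  have lt := fun k => mul_lt_mul_of_pos_left (weight.wsum_morsePeriodic_lt k) scale
  have exhaust := fun v => MarkoffLagrange.exists_eq_wsum_morsePeriodic_of_mem_spectrum (v := v)
    hP hroots hsimple hα hsum
  simp only [MarkoffLagrange.Emulti_eq_wsum hβ₀ hβ₁ weight,
    MarkoffLagrange.EmultiFin_eq_wsum hβ₀ hβ₁]
  refine ⟨MarkoffLagrange.isLeast_setOf_accPt
    (weight.tendsto_wsum_morsePeriodic.const_mul _) mem (fun k => (lt k).ne) exhaust,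
    Set.ext fun v => ⟨?_, ?_⟩⟩
  · rintro ⟨hv, hv_pos, hv_lt⟩
    obtain ⟨_ | k, rfl⟩ := exhaust v hv hv_lt
    · simp [MarkoffLagrange.wsum_morsePeriodic_zero] at hv_pos
    · exact ⟨k, rfl⟩
  · rintro ⟨k, rfl⟩
    exact ⟨mem (k + 1), mul_pos scale (weight.wsum_morsePeriodic_succ_pos k), lt (k + 1)⟩
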